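/- **Setting.** Let $t_{\max}\in\mathbb R$, let $a\colon(-\infty,t_{\max})\to(0,\infty)$ be smooth, and let $H=\dot a/a$. Let $g=-\mathrm dt^2+a(t)^2(\mathrm dx^2+\mathrm dy^2+\mathrm dz^2)$ be the flat FLRW metric on $(-\infty,t_{\max})\times\mathbb R^3$, time oriented by $\partial_t$. Fix $t_0<t_{\max}$ and put $M_{t_0}=(-\infty,t_0)\times\mathbb R^3$. The Einstein static universe is $\widetilde M=\mathbb R\times\mathbb S^3$ with $\tilde g=-(\mathrm dT')^2+h_{\mathbb S^3}$, where $h_{\mathbb S^3}$ is the round metric of the unit sphere, time oriented by $\partial_{T'}$. Let $\chi\in[0,\pi]$ be the polar angle on $\mathbb S^3$ measured from the north pole. Put $$\mathcal O=\{T'=-\tfrac\pi2,\ \chi=0\},\quad \mathcal P=\{T'=\tfrac\pi2,\ \chi=\pi\},\quad \Sigma^+=\{T'=\tfrac\pi2\},$$ $$\mathcal B^-=\{T'=\chi-\tfrac\pi2,\ -\tfrac\pi2<T'<\tfrac\pi2,\ 0<\chi<\pi\}.$$ **Definitions.** A future- (past-)directed timelike curve is a piecewise $C^1$ curve on a compact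 interval $[\alpha,\beta]$, $\alpha<\beta$, all of whose velocities, including the one-sided ones at break points and endpoints, are future- (past-)directed timelike. $I^+_{\tilde g}(p,U)$ is the set of endpoints of future-directed $\tilde g$-timelike curves in $U$ that start at $p$. A $C^0$ conformal embedding of $(M_{t_0},g)$ into $(\widetilde M,\tilde g)$ is an embedding $M_{t_0}\hookrightarrow\widetilde M$ of manifolds onto a proper open subset, which we identify with $M_{t_0}$, together with a continuous conformal factor $\Omega\colon\overline{M_{t_0}}\to[0,\infty)$, such that $\Omega$ is smooth and positive on $M_{t_0}$, $\tilde g$ pulls back to $\Omega^2 g$, and the conformal boundary $\partial_0M_{t_0}=\{p\in\partial M_{t_0}:\Omega(p)=0\}$ is non-empty. Here the closure and the boundary are taken in $\widetilde M$. A future- (past-)terminating timelike curve for $p\in\partial M_{t_0}$ is a future- (past-)directed $\tilde g$-timelike curve $\gamma\colon[\alpha,\beta]\to\widetilde M$ with $\gamma(\beta)=p$ and $\gamma([\alpha,\beta))\subset M_{t_0}$. The future and past conformal boundaries $\partial_0^{\pm}M_{t_0}$ are the sets of $p\in\partial_0M_{t_0}$ that have a future-, respectively past-terminating timelike curve. The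 future and past boundaries $\partial^{\pm}M_{t_0}$ are the sets of such $p\in\partial M_{t_0}\setminus\partial_0M_{t_0}$. **Proposition 4.2.** Suppose that for some $h>0$, as $t\to-\infty$, either $a(t)=e^{ht}+o(e^{ht})$ or $H(t)\to h$. Then there is a $C^0$ conformal embedding of $(M_{t_0},g)$ into the Einstein static universe $(\widetilde M,\tilde g)$, given by a $C^\infty$ map, such that * (a) on $M_{t_0}$ the conformal factor is $\Omega=\dfrac{h\cos T'}{\omega(t)}$, where $\omega(t)=h\,a(t)\displaystyle\int_t^{t_0}\frac{\mathrm ds}{a(s)}$; * (b) $\partial_0M_{t_0}=\{\mathcal O\}\sqcup\{\mathcal P\}$, $\partial_0^-M_{t_0}=\{\mathcal O\}$ and $\partial_0^+M_{t_0}=\emptyset$; * (c) $\partial^-M_{t_0}=\mathcal B^-$ and $\partial^+M_{t_0}=\Sigma^+\setminus\{\mathcal P\}$; * (d) for every $x\in\mathbb R^3$ the comoving observer $t\mapsto(t,x)$ tends to $\mathcal O$ as $t\to-\infty$; * (e) there is an open set $\widetilde M'\subset\widetilde M$ containing $\mathcal O$ with $M_{t_0}=I^+_{\tilde g}(\mathcal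 O,\widetilde M')$; in fact one can take $\widetilde M'=(-\infty,\tfrac\pi2)\times\mathbb S^3$. -/

import Mathlib

open scoped Manifold ContDiff Topology
open Set Filter Asymptotics

noncomputable section

/-! ### Spacetimes and their causal structure -/

section Spacetime

variable {E : Type*} [NormedAddCommGroup E] [NormedSpace ℝ E]
  {H : Type*} [TopologicalSpace H]

/-- A `C^k` spacetime: a connected, Hausdorff, second countable, four-dimensional manifold `M`
(without boundary) of class `C^{k+1}`, with a `C^k` Lorentzian metric of signature `(-,+,+,+)` and
a time orientation given by a continuous timelike vector field.

The metric is `C^k` when `v ↦ g(v,v)` is `C^k` on the tangent bundle; by polarization this says that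
all its components in charts are `C^k`. -/
structure Spacetime (k : ℕ∞) (I : ModelWithCorners ℝ E H) (M : Type*) [TopologicalSpace M]
    [ChartedSpace H M] [IsManifold I 1 M] where
  isManifold : IsManifold I (k + 1) M
  boundaryless : BoundarylessManifold I M
  finrank_eq : Module.finrank ℝ E = 4
  t2 : T2Space M
  secondCountable : SecondCountableTopology M
  connected : ConnectedSpace M
  /-- The metric tensor. -/
  metric : ∀ x : M, LinearMap.BilinForm ℝ (TangentSpace I x)
  symm : ∀ (x : M) (v w : TangentSpace I x), metric x v w = metric x w v
  /-- Signature `(-,+,+,+)`: some timelike vector has a positive definite orthogonal complement. -/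
  lorentzian : ∀ x : M, ∃ v : TangentSpace I x, metric x v v < 0 ∧
    ∀ w : TangentSpace I x, metric x v w = 0 → w ≠ 0 → 0 < metric x w w
  contMDiff_metric :
    ContMDiff I.tangent 𝓘(ℝ, ℝ) k (fun v : TangentBundle I M => metric v.1 v.2 v.2)
  /-- The future-directed timelike vector field that fixes the time orientation. -/
  timeField : ∀ x : M, TangentSpace I x
  continuous_timeField : Continuous (fun x : M => (⟨x, timeField x⟩ : TangentBundle I M))
  timeField_timelike : ∀ x : M, metric x (timeField x) (timeField x) < 0

namespace Spacetime

variable {k : ℕ∞} {I : ModelWithCorners ℝ E H} {M : Type*} [TopologicalSpace M]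
  [ChartedSpace H M] [IsManifold I 1 M]

/-- `v` is timelike and in the same half of the light cone as the time orientation field. -/
def IsFutureTimelike (S : Spacetime k I M) (x : M) (v : TangentSpace I x) : Prop :=
  S.metric x v v < 0 ∧ S.metric x v (S.timeField x) < 0

/-- `v` is timelike and in the half of the light cone opposite to the time orientation field. -/
def IsPastTimelike (S : Spacetime k I M) (x : M) (v : TangentSpace I x) : Prop :=
  S.metric x v v < 0 ∧ 0 < S.metric x v (S.timeField x)

/-- `γ : [a,b] → M` is a piecewise `C^1` curve all of whose velocity vectors, including the two
one-sided ones at each break point and the one-sided ones at the endpoints, satisfy `P`: there is a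
partition `a = s 0 < s 1 < ⋯ < s n = b`, `n ≥ 1`, such that `γ` is `C^1` with velocities in `P` on
each closed piece `[s i, s (i+1)]`. Only the values of `γ` on `[a,b]` matter. -/
def IsPiecewiseC1With (I : ModelWithCorners ℝ E H) {M : Type*} [TopologicalSpace M]
    [ChartedSpace H M] (P : ∀ x : M, TangentSpace I x → Prop) (γ : ℝ → M) (a b : ℝ) : Prop :=
  ∃ (n : ℕ) (s : ℕ → ℝ), 0 < n ∧ s 0 = a ∧ s n = b ∧ ∀ i < n, s i < s (i + 1) ∧
    ContMDiffOn 𝓘(ℝ, ℝ) I 1 γ (Icc (s i) (s (i + 1))) ∧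
    ∀ u ∈ Icc (s i) (s (i + 1)),
      P (γ u) (mfderivWithin 𝓘(ℝ, ℝ) I γ (Icc (s i) (s (i + 1))) u (1 : ℝ))

/-- `γ : [a,b] → M` is a future-directed timelike curve. -/
def IsFutureTimelikeCurve (S : Spacetime k I M) (γ : ℝ → M) (a b : ℝ) : Prop :=
  IsPiecewiseC1With I S.IsFutureTimelike γ a b

/-- `γ : [a,b] → M` is a past-directed timelike curve. -/
def IsPastTimelikeCurve (S : Spacetime k I M) (γ : ℝ → M) (a b : ℝ) : Prop :=
  IsPiecewiseC1With I S.IsPastTimelike γ a b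

/-- The timelike future `I⁺(p, U)` of `p` with respect to `U`: the points reached from `p` by
future-directed timelike curves lying in `U`. -/
def timelikeFuture (S : Spacetime k I M) (p : M) (U : Set M) : Set M :=
  {q | ∃ (γ : ℝ → M) (a b : ℝ), S.IsFutureTimelikeCurve γ a b ∧
    MapsTo γ (Icc a b) U ∧ γ a = p ∧ γ b = q}

/-- There is a future-terminating timelike curve for `p`, with respect to the open set `A`. -/
def HasFutureTerminatingCurve (S : Spacetime k I M) (A : Set M) (p : M) : Prop :=
  ∃ (γ : ℝ → M) (a b : ℝ), S.IsFutureTimelikeCurve γ a b ∧ γ b = p ∧ MapsTo γ (Ico a b) A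

/-- There is a past-terminating timelike curve for `p`, with respect to the open set `A`. -/
def HasPastTerminatingCurve (S : Spacetime k I M) (A : Set M) (p : M) : Prop :=
  ∃ (γ : ℝ → M) (a b : ℝ), S.IsPastTimelikeCurve γ a b ∧ γ b = p ∧ MapsTo γ (Ico a b) A

end Spacetime

end Spacetime

/-! ### Conformal embeddings and boundaries -/

section ConformalEmbedding

variable {E : Type*} [NormedAddCommGroup E] [NormedSpace ℝ E]
  {H : Type*} [TopologicalSpace H] {I : ModelWithCorners ℝ E H}
  {M : Type*} [TopologicalSpace M] [ChartedSpace H M] [IsManifold I 1 M]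
  {E' : Type*} [NormedAddCommGroup E'] [NormedSpace ℝ E']
  {H' : Type*} [TopologicalSpace H'] {I' : ModelWithCorners ℝ E' H'}
  {M' : Type*} [TopologicalSpace M'] [ChartedSpace H' M'] [IsManifold I' 1 M']
  {k : ℕ∞}

/-- The conformal boundary `∂₀A` of the region `A`, for a conformal factor `Ω` (of which only the
values on the closure of `A` matter). -/
def conformalBoundary (A : Set M') (Ω : M' → ℝ) : Set M' :=
  {p | p ∈ frontier A ∧ Ω p = 0}

/-- `φ : M → M'` is a `C^k` conformal embedding of the smooth spacetime `S` into the `C^k`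
spacetime `S'`, with conformal factor `Ω` on the closure of the image (the values of `Ω` elsewhere
are irrelevant).

`φ` is an embedding of manifolds: an injective immersion of class `C^{k+1}`, the class of `M'`,
that is a homeomorphism onto its image. -/
structure IsConformalEmbedding (S : Spacetime ⊤ I M) (S' : Spacetime k I' M')
    (φ : M → M') (Ω : M' → ℝ) : Prop where
  contMDiff : ContMDiff I I' (k + 1) φ
  immersion : ∀ x : M, Function.Injective (mfderiv I I' φ x)
  isEmbedding : Topology.IsEmbedding φ
  isOpen_range : IsOpen (range φ)
  range_ne_univ : range φ ≠ univ
  contMDiffOn_factor : ContMDiffOn I' 𝓘(ℝ, ℝ) k Ω (closure (range φ))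
  factor_nonneg : ∀ p ∈ closure (range φ), 0 ≤ Ω p
  contMDiff_factor : ContMDiff I 𝓘(ℝ, ℝ) ∞ (Ω ∘ φ)
  factor_pos : ∀ x : M, 0 < Ω (φ x)
  conformalBoundary_nonempty : (conformalBoundary (range φ) Ω).Nonempty
  pullback_eq : ∀ (x : M) (v w : TangentSpace I x),
    S'.metric (φ x) (mfderiv I I' φ x v) (mfderiv I I' φ x w) = Ω (φ x) ^ 2 * S.metric x v w

/-- The future conformal boundary `∂₀⁺A`. -/
def futureConformalBoundary (S' : Spacetime k I' M') (A : Set M') (Ω : M' → ℝ) : Set M' :=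
  {p | p ∈ conformalBoundary A Ω ∧ S'.HasFutureTerminatingCurve A p}

/-- The past conformal boundary `∂₀⁻A`. -/
def pastConformalBoundary (S' : Spacetime k I' M') (A : Set M') (Ω : M' → ℝ) : Set M' :=
  {p | p ∈ conformalBoundary A Ω ∧ S'.HasPastTerminatingCurve A p}

/-- The future boundary `∂⁺A`. -/
def futureBoundary (S' : Spacetime k I' M') (A : Set M') (Ω : M' → ℝ) : Set M' :=
  {p | p ∈ frontier A \ conformalBoundary A Ω ∧ S'.HasFutureTerminatingCurve A p}

/-- The past boundary `∂⁻A`. -/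
def pastBoundary (S' : Spacetime k I' M') (A : Set M') (Ω : M' → ℝ) : Set M' :=
  {p | p ∈ frontier A \ conformalBoundary A Ω ∧ S'.HasPastTerminatingCurve A p}

end ConformalEmbedding

/-! ### Metrics of the form `-dτ² + s² ⟨dξ, dξ⟩` -/

section WarpedForm

variable {E : Type*} [NormedAddCommGroup E] [NormedSpace ℝ E]
  {H : Type*} [TopologicalSpace H] {I : ModelWithCorners ℝ E H}
  {M : Type*} [TopologicalSpace M] [ChartedSpace H M]
  {F : Type*} [NormedAddCommGroup F] [InnerProductSpace ℝ F]

/-- The symmetric form `-dτ² + s² ⟨dξ, dξ⟩` on the tangent spaces of `M`, for a real function `τ`,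
a map `ξ` to a Euclidean space, and a function `s`. -/
def warpedForm (I : ModelWithCorners ℝ E H) {M : Type*} [TopologicalSpace M] [ChartedSpace H M]
    (τ : M → ℝ) (s : M → ℝ) (ξ : M → F) (x : M) : LinearMap.BilinForm ℝ (TangentSpace I x) :=
  LinearMap.mk₂ ℝ
    (fun v w => -(mvfderiv I τ x v * mvfderiv I τ x w)
      + s x ^ 2 * inner ℝ (mvfderiv I ξ x v) (mvfderiv I ξ x w))
    (fun v v' w => by simp only [map_add, inner_add_left]; ring)
    (fun c v w => by simp only [map_smul, inner_smul_left, smul_eq_mul]; simp; ring)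
    (fun v w w' => by simp only [map_add, inner_add_right]; ring)
    (fun c v w => by simp only [map_smul, inner_smul_right, smul_eq_mul]; ring)

theorem warpedForm_apply (τ s : M → ℝ) (ξ : M → F) (x : M) (v w : TangentSpace I x) :
    warpedForm I τ s ξ x v w = -(mvfderiv I τ x v * mvfderiv I τ x w)
      + s x ^ 2 * inner ℝ (mvfderiv I ξ x v) (mvfderiv I ξ x w) := rfl

theorem warpedForm_symm (τ s : M → ℝ) (ξ : M → F) (x : M) (v w : TangentSpace I x) :
    warpedForm I τ s ξ x v w = warpedForm I τ s ξ x w v := by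
  simp only [warpedForm_apply, real_inner_comm, mul_comm]

theorem warpedForm_neg {τ s : M → ℝ} {ξ : M → F} {x : M} {v : TangentSpace I x}
    (hτ : mvfderiv I τ x v = 1) (hξ : mvfderiv I ξ x v = 0) : warpedForm I τ s ξ x v v < 0 := by
  simp [warpedForm_apply, hτ, hξ]

theorem warpedForm_lorentzian {τ s : M → ℝ} {ξ : M → F} {x : M} {v : TangentSpace I x}
    (hs : 0 < s x) (hτ : mvfderiv I τ x v = 1) (hξ : mvfderiv I ξ x v = 0)
    (hinj : ∀ w : TangentSpace I x, mvfderiv I τ x w = 0 → mvfderiv I ξ x w = 0 → w = 0) :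
    ∃ v : TangentSpace I x, warpedForm I τ s ξ x v v < 0 ∧
      ∀ w : TangentSpace I x, warpedForm I τ s ξ x v w = 0 → w ≠ 0 →
        0 < warpedForm I τ s ξ x w w := by
  refine ⟨v, warpedForm_neg hτ hξ, fun w hw hw0 => ?_⟩
  have h0 : mvfderiv I τ x w = 0 := by simpa [warpedForm_apply, hτ, hξ] using hw
  have h1 : mvfderiv I ξ x w ≠ 0 := fun h => hw0 (hinj w h0 h)
  have h2 : 0 < inner ℝ (mvfderiv I ξ x w) (mvfderiv I ξ x w) := real_inner_self_pos.2 h1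
  simp only [warpedForm_apply, h0]
  have := mul_pos (pow_pos hs 2) h2
  linarith

theorem contMDiff_mvfderiv_tangentBundle [IsManifold I 1 M] {G : Type*} [NormedAddCommGroup G]
    [NormedSpace ℝ G] {f : M → G} (hf : ContMDiff I 𝓘(ℝ, G) ∞ f) :
    ContMDiff I.tangent 𝓘(ℝ, G) ∞ (fun v : TangentBundle I M => mvfderiv I f v.1 v.2) :=
  (contMDiff_snd_tangentBundle_modelSpace G 𝓘(ℝ, G)).comp
    (hf.contMDiff_tangentMap (m := ∞) le_rfl)

theorem contMDiff_warpedForm [IsManifold I ∞ M] [IsManifold I 1 M] {τ s : M → ℝ} {ξ : M → F}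
    (hτ : ContMDiff I 𝓘(ℝ, ℝ) ∞ τ) (hs : ContMDiff I 𝓘(ℝ, ℝ) ∞ s)
    (hξ : ContMDiff I 𝓘(ℝ, F) ∞ ξ) :
    ContMDiff I.tangent 𝓘(ℝ, ℝ) ∞
      (fun v : TangentBundle I M => warpedForm I τ s ξ v.1 v.2 v.2) := by
  have h1 := contMDiff_mvfderiv_tangentBundle hτ
  have h2 := contMDiff_mvfderiv_tangentBundle hξ
  have h3 : ContMDiff I.tangent 𝓘(ℝ, ℝ) ∞ (fun v : TangentBundle I M => s v.1) :=
    hs.comp (Bundle.contMDiff_proj (TangentSpace I))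
  have h4 : ContMDiff I.tangent 𝓘(ℝ, ℝ) ∞ (fun v : TangentBundle I M =>
      inner ℝ (mvfderiv I ξ v.1 v.2) (mvfderiv I ξ v.1 v.2)) :=
    (contDiff_inner (𝕜 := ℝ) (E := F)).contMDiff.comp (h2.prodMk_space h2)
  exact ((h1.mul h1).neg).add ((h3.pow 2).mul h4)

end WarpedForm

/-! ### Open subsets of a vector space as manifolds -/

section Opens

variable {E : Type*} [NormedAddCommGroup E] [NormedSpace ℝ E]

theorem opens_extChartAt_symm (U : TopologicalSpace.Opens E) (x : U) (y : E) (hy : y ∈ U) :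
    ((extChartAt 𝓘(ℝ, E) x).symm y : E) = y := by
  have h := (U.openPartialHomeomorphSubtypeCoe ⟨x⟩).right_inv (x := y) (by simpa using hy)
  simpa [extChartAt, TopologicalSpace.Opens.chartAt_eq, chartAt_self_eq,
    OpenPartialHomeomorph.subtypeRestr] using h

theorem opens_extChartAt_apply (U : TopologicalSpace.Opens E) (x y : U) :
    extChartAt 𝓘(ℝ, E) x y = (y : E) := by
  simp [extChartAt, TopologicalSpace.Opens.chartAt_eq, chartAt_self_eq]

/-- The tangent space to an open subset `U` of `E` is `E`, through the derivative of the
inclusion. -/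
theorem opens_mvfderiv_val (U : TopologicalSpace.Opens E) (x : U) (v : TangentSpace 𝓘(ℝ, E) x) :
    mvfderiv 𝓘(ℝ, E) (Subtype.val : U → E) x v = (v : E) := by
  have hd : MDifferentiableAt 𝓘(ℝ, E) 𝓘(ℝ, E) (Subtype.val : U → E) x :=
    (contMDiff_subtype_val (n := 1)).mdifferentiable (by simp) x
  rw [hd.mvfderiv]
  have : (fderivWithin ℝ (writtenInExtChartAt 𝓘(ℝ, E) 𝓘(ℝ, E) x (Subtype.val : U → E))
      (range 𝓘(ℝ, E)) (extChartAt 𝓘(ℝ, E) x x)) = ContinuousLinearMap.id ℝ E := by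
    have h1 : writtenInExtChartAt 𝓘(ℝ, E) 𝓘(ℝ, E) x (Subtype.val : U → E) =ᶠ[𝓝 (x : E)] id := by
      filter_upwards [U.2.mem_nhds x.2] with y hy
      simpa [writtenInExtChartAt, chartAt_self_eq] using opens_extChartAt_symm U x y hy
    rw [opens_extChartAt_apply, modelWithCornersSelf_coe, range_id, fderivWithin_univ,
      h1.fderiv_eq, fderiv_id]
  exact congrArg (fun f : E →L[ℝ] E => f v) this

theorem opens_continuous_const (U : TopologicalSpace.Opens E) (v : E) :
    Continuous (fun x : U => (⟨x, v⟩ : TangentBundle 𝓘(ℝ, E) U)) := by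
  rw [continuous_iff_continuousAt]
  intro x
  rw [FiberBundle.continuousAt_totalSpace]
  refine ⟨continuousAt_id, ?_⟩
  have : (fun y : U => ((trivializationAt E (TangentSpace 𝓘(ℝ, E)) x)
      (⟨y, v⟩ : TangentBundle 𝓘(ℝ, E) U)).2) = fun _ => v := by
    funext y
    rw [TangentBundle.trivializationAt_apply]
    have h1 : extChartAt 𝓘(ℝ, E) x ∘ (extChartAt 𝓘(ℝ, E) y).symm =ᶠ[𝓝 (y : E)] id := by
      filter_upwards [U.2.mem_nhds y.2] with z hz
      simp only [Function.comp, opens_extChartAt_apply, opens_extChartAt_symm U y z hz, id]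
    change fderivWithin ℝ (extChartAt 𝓘(ℝ, E) x ∘ (extChartAt 𝓘(ℝ, E) y).symm)
      (range 𝓘(ℝ, E)) (extChartAt 𝓘(ℝ, E) y y) v = v
    rw [opens_extChartAt_apply, modelWithCornersSelf_coe, range_id, fderivWithin_univ,
      h1.fderiv_eq, fderiv_id]
    rfl
  rw [this]
  exact continuousAt_const

end Opens

/-! ### Flat FLRW spacetimes -/

/-- The region `(-∞, t₀) × ℝ³`, an open subset of `ℝ × ℝ³`. -/
def FLRWRegion (t₀ : ℝ) : TopologicalSpace.Opens (ℝ × EuclideanSpace ℝ (Fin 3)) :=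
  ⟨{p | p.1 < t₀}, isOpen_lt continuous_fst continuous_const⟩

namespace FLRWRegion

variable {t₀ : ℝ}

/-- The time coordinate `t`. -/
def time (p : FLRWRegion t₀) : ℝ := p.1.1

/-- The Cartesian coordinates `(x, y, z)`. -/
def space (p : FLRWRegion t₀) : EuclideanSpace ℝ (Fin 3) := p.1.2

/-- The comoving observer `t ↦ (t, x)` at the point `x` of `ℝ³`. -/
def comoving (x : EuclideanSpace ℝ (Fin 3)) (t : Iio t₀) : FLRWRegion t₀ := ⟨(t.1, x), t.2⟩

theorem contMDiff_time : ContMDiff 𝓘(ℝ, ℝ × EuclideanSpace ℝ (Fin 3)) 𝓘(ℝ, ℝ) ∞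
    (time : FLRWRegion t₀ → ℝ) :=
  contDiff_fst.contMDiff.comp contMDiff_subtype_val

theorem contMDiff_space : ContMDiff 𝓘(ℝ, ℝ × EuclideanSpace ℝ (Fin 3))
    𝓘(ℝ, EuclideanSpace ℝ (Fin 3)) ∞ (space : FLRWRegion t₀ → EuclideanSpace ℝ (Fin 3)) :=
  contDiff_snd.contMDiff.comp contMDiff_subtype_val

theorem mvfderiv_time (p : FLRWRegion t₀)
    (v : TangentSpace 𝓘(ℝ, ℝ × EuclideanSpace ℝ (Fin 3)) p) :
    mvfderiv 𝓘(ℝ, ℝ × EuclideanSpace ℝ (Fin 3)) (time : FLRWRegion t₀ → ℝ) p v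
      = (show ℝ × EuclideanSpace ℝ (Fin 3) from v).1 := by
  have h : mvfderiv 𝓘(ℝ, ℝ × EuclideanSpace ℝ (Fin 3)) (time : FLRWRegion t₀ → ℝ) p =
      (ContinuousLinearMap.fst ℝ ℝ (EuclideanSpace ℝ (Fin 3))).comp
        (mvfderiv 𝓘(ℝ, ℝ × EuclideanSpace ℝ (Fin 3)) (Subtype.val : FLRWRegion t₀ → _) p) :=
    (((ContinuousLinearMap.fst ℝ ℝ (EuclideanSpace ℝ (Fin 3))).hasFDerivAt.hasMFDerivAt).comp p
      ((contMDiff_subtype_val (n := 1)).mdifferentiable (by simp) p).hasMFDerivAt).mfderiv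
  rw [h, ContinuousLinearMap.comp_apply, opens_mvfderiv_val]
  rfl

theorem mvfderiv_space (p : FLRWRegion t₀)
    (v : TangentSpace 𝓘(ℝ, ℝ × EuclideanSpace ℝ (Fin 3)) p) :
    mvfderiv 𝓘(ℝ, ℝ × EuclideanSpace ℝ (Fin 3)) (space : FLRWRegion t₀ → _) p v
      = (show ℝ × EuclideanSpace ℝ (Fin 3) from v).2 := by
  have h : mvfderiv 𝓘(ℝ, ℝ × EuclideanSpace ℝ (Fin 3)) (space : FLRWRegion t₀ → _) p =
      (ContinuousLinearMap.snd ℝ ℝ (EuclideanSpace ℝ (Fin 3))).comp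
        (mvfderiv 𝓘(ℝ, ℝ × EuclideanSpace ℝ (Fin 3)) (Subtype.val : FLRWRegion t₀ → _) p) :=
    (((ContinuousLinearMap.snd ℝ ℝ (EuclideanSpace ℝ (Fin 3))).hasFDerivAt.hasMFDerivAt).comp p
      ((contMDiff_subtype_val (n := 1)).mdifferentiable (by simp) p).hasMFDerivAt).mfderiv
  rw [h, ContinuousLinearMap.comp_apply, opens_mvfderiv_val]
  rfl

end FLRWRegion

/-- The flat FLRW spacetime `(-∞, t₀) × ℝ³` with metric `-dt² + a(t)² (dx² + dy² + dz²)`, time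
oriented by `∂_t`. -/
def flrw (a : ℝ → ℝ) (t₀ : ℝ) (ha : ContDiffOn ℝ ∞ a (Iio t₀)) (hpos : ∀ t < t₀, 0 < a t) :
    Spacetime ⊤ 𝓘(ℝ, ℝ × EuclideanSpace ℝ (Fin 3)) (FLRWRegion t₀) where
  isManifold := inferInstance
  boundaryless := inferInstance
  finrank_eq := by simp
  t2 := inferInstance
  secondCountable := inferInstance
  connected := by
    refine Subtype.connectedSpace ⟨⟨(t₀ - 1, 0), by simp [FLRWRegion]⟩, ?_⟩
    exact (((convex_Iio t₀).is_linear_preimage (IsLinearMap.mk (fun _ _ => rfl) fun _ _ => rfl) :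
      Convex ℝ (Prod.fst ⁻¹' Iio t₀ : Set (ℝ × EuclideanSpace ℝ (Fin 3))))).isPreconnected
  metric := warpedForm 𝓘(ℝ, ℝ × EuclideanSpace ℝ (Fin 3)) FLRWRegion.time
    (fun p => a (FLRWRegion.time p)) FLRWRegion.space
  symm := warpedForm_symm _ _ _
  lorentzian := fun p => by
    refine warpedForm_lorentzian (v := ((1 : ℝ), (0 : EuclideanSpace ℝ (Fin 3))))
      (hpos _ p.2) (FLRWRegion.mvfderiv_time p _) (FLRWRegion.mvfderiv_space p _) ?_
    intro w h1 h2
    rw [FLRWRegion.mvfderiv_time] at h1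
    rw [FLRWRegion.mvfderiv_space] at h2
    exact Prod.ext h1 h2
  contMDiff_metric := by
    refine contMDiff_warpedForm FLRWRegion.contMDiff_time (fun p => ?_)
      FLRWRegion.contMDiff_space
    exact ((ha.contDiffAt (Iio_mem_nhds p.2)).contMDiffAt).comp p
      (FLRWRegion.contMDiff_time p)
  timeField := fun _ => ((1 : ℝ), (0 : EuclideanSpace ℝ (Fin 3)))
  continuous_timeField := opens_continuous_const _ _
  timeField_timelike := fun p => warpedForm_neg
    (FLRWRegion.mvfderiv_time p _) (FLRWRegion.mvfderiv_space p _)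

/-! ### The Einstein static universe -/

/-- The unit sphere `𝕊³` in `ℝ⁴`. -/
abbrev S3 : Type := Metric.sphere (0 : EuclideanSpace ℝ (Fin 4)) 1

theorem finrank_four : Fact (Module.finrank ℝ (EuclideanSpace ℝ (Fin 4)) = 3 + 1) := ⟨by simp⟩

theorem contMDiff_coe_S3 :
    ContMDiff (𝓡 3) 𝓘(ℝ, EuclideanSpace ℝ (Fin 4)) ∞ (Subtype.val : S3 → EuclideanSpace ℝ (Fin 4)) :=
  haveI := finrank_four
  contMDiff_coe_sphere

theorem injective_mvfderiv_coe_S3 (q : S3) : Function.Injective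
    (mvfderiv (𝓡 3) (Subtype.val : S3 → EuclideanSpace ℝ (Fin 4)) q) :=
  haveI := finrank_four
  injective_mvfderiv_subtypeVal_sphere q

theorem mvfderiv_esu_time (p : ℝ × S3) (v : TangentSpace (𝓘(ℝ, ℝ).prod (𝓡 3)) p) :
    mvfderiv (𝓘(ℝ, ℝ).prod (𝓡 3)) (Prod.fst : ℝ × S3 → ℝ) p v
      = (show ℝ × EuclideanSpace ℝ (Fin 3) from v).1 := by
  have h : mvfderiv (𝓘(ℝ, ℝ).prod (𝓡 3)) (Prod.fst : ℝ × S3 → ℝ) p =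
    ContinuousLinearMap.fst ℝ ℝ (EuclideanSpace ℝ (Fin 3)) := mfderiv_fst
  rw [h]
  rfl

theorem mvfderiv_esu_space (p : ℝ × S3) (v : TangentSpace (𝓘(ℝ, ℝ).prod (𝓡 3)) p) :
    mvfderiv (𝓘(ℝ, ℝ).prod (𝓡 3)) (fun p : ℝ × S3 => (p.2 : EuclideanSpace ℝ (Fin 4))) p v
      = mvfderiv (𝓡 3) (Subtype.val : S3 → EuclideanSpace ℝ (Fin 4)) p.2
        (show ℝ × EuclideanSpace ℝ (Fin 3) from v).2 := by
  have h : mvfderiv (𝓘(ℝ, ℝ).prod (𝓡 3))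
      (fun p : ℝ × S3 => (p.2 : EuclideanSpace ℝ (Fin 4))) p =
    (mvfderiv (𝓡 3) (Subtype.val : S3 → EuclideanSpace ℝ (Fin 4)) p.2).comp
      (ContinuousLinearMap.snd ℝ ℝ (EuclideanSpace ℝ (Fin 3))) :=
    ((contMDiff_coe_S3.mdifferentiable (by simp) p.2).hasMFDerivAt.comp p
      (hasMFDerivAt_snd p)).mfderiv
  rw [h]
  rfl

/-- The Einstein static universe `(ℝ × 𝕊³, -(dT')² + h)`, where the round metric `h` is induced by
the inclusion of `𝕊³` in `ℝ⁴`, time oriented by `∂_{T'}`. It is smooth, hence a `C^k` spacetime for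
every `k`. -/
def einsteinStatic (k : ℕ∞) : Spacetime k (𝓘(ℝ, ℝ).prod (𝓡 3)) (ℝ × S3) where
  isManifold := IsManifold.of_le (n := ω) le_top
  boundaryless := inferInstance
  finrank_eq := by simp
  t2 := inferInstance
  secondCountable := inferInstance
  connected := by
    have : ConnectedSpace S3 := Subtype.connectedSpace
      (isConnected_sphere (by rw [← Module.finrank_eq_rank]; simp) 0 zero_le_one)
    infer_instance
  metric := warpedForm (𝓘(ℝ, ℝ).prod (𝓡 3)) Prod.fst (fun _ => 1)
    (fun p => (p.2 : EuclideanSpace ℝ (Fin 4)))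
  symm := warpedForm_symm _ _ _
  lorentzian := fun p => by
    refine warpedForm_lorentzian (v := ((1 : ℝ), (0 : EuclideanSpace ℝ (Fin 3)))) one_pos
      (mvfderiv_esu_time p _) ((mvfderiv_esu_space p _).trans (map_zero _)) ?_
    intro w h1 h2
    rw [mvfderiv_esu_time] at h1
    rw [mvfderiv_esu_space] at h2
    exact Prod.ext h1 (injective_mvfderiv_coe_S3 p.2 (h2.trans (map_zero _).symm))
  contMDiff_metric :=
    (contMDiff_warpedForm contMDiff_fst contMDiff_const
      (contMDiff_coe_S3.comp contMDiff_snd)).of_le (by exact_mod_cast le_top)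
  timeField := fun _ => ((1 : ℝ), (0 : EuclideanSpace ℝ (Fin 3)))
  continuous_timeField := by
    have h1 : Continuous (fun x : ℝ => (⟨x, (1 : ℝ)⟩ : TangentBundle 𝓘(ℝ, ℝ) ℝ)) :=
      (contMDiff_vectorSpace_iff_contDiff (n := 0) (V := fun _ : ℝ => (1 : ℝ)).2
        contDiff_const).continuous
    have h2 : Continuous (fun q : S3 => (⟨q, 0⟩ : TangentBundle (𝓡 3) S3)) :=
      (Bundle.contMDiff_zeroSection (IB := 𝓡 3) (n := 0) (F := EuclideanSpace ℝ (Fin 3)) ℝ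
        (TangentSpace (𝓡 3) : S3 → Type)).continuous
    exact (contMDiff_equivTangentBundleProd_symm (n := 0) (I := 𝓘(ℝ, ℝ)) (M := ℝ) (I' := 𝓡 3)
      (M' := S3)).continuous.comp ((h1.comp continuous_fst).prodMk (h2.comp continuous_snd))
  timeField_timelike := fun p => warpedForm_neg
    (mvfderiv_esu_time p _) ((mvfderiv_esu_space p _).trans (map_zero _))

namespace EinsteinStatic

/-- The polar angle `χ ∈ [0, π]` of `𝕊³`, measured from the north pole `(1,0,0,0)`. -/
def chi (q : S3) : ℝ := Real.arccos (q.1 0)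

/-- The north pole `χ = 0` of `𝕊³`. -/
def northPole : S3 := ⟨EuclideanSpace.single 0 1, by simp⟩

/-- The south pole `χ = π` of `𝕊³`. -/
def southPole : S3 := -northPole

/-- The point `𝒪`: the north pole at `T' = -π/2`. -/
def pointO : ℝ × S3 := (-(Real.pi / 2), northPole)

/-- The point `𝒫`: the south pole at `T' = π/2`. -/
def pointP : ℝ × S3 := (Real.pi / 2, southPole)

/-- The null cone `ℬ⁻ = {T' = χ - π/2, -π/2 < T' < π/2, 0 < χ < π}`. -/
def coneB : Set (ℝ × S3) :=
  {p | p.1 ∈ Ioo (-(Real.pi / 2)) (Real.pi / 2) ∧ chi p.2 ∈ Ioo 0 Real.pi ∧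
    p.1 = chi p.2 - Real.pi / 2}

/-- The hypersurface `Σ⁺ = {T' = π/2}`. -/
def sigmaPlus : Set (ℝ × S3) := {p | p.1 = Real.pi / 2}

/-- The open region `(-∞, π/2) × 𝕊³`. -/
def belowSigma : Set (ℝ × S3) := {p | p.1 < Real.pi / 2}

end EinsteinStatic

/-- The function `ω(t) = h a(t) ∫_t^{t₀} ds / a(s)`. -/
def omegaFactor (a : ℝ → ℝ) (h t₀ t : ℝ) : ℝ := h * a t * ∫ s in t..t₀, 1 / a s

end

noncomputable section

/-! ### L'Hôpital's rule of type `∞/∞` at `-∞` -/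

theorem eventually_div_lt_of_deriv_div_atBot {f g f' g' : ℝ → ℝ} {L c t₁ : ℝ}
    (hf : ∀ t < t₁, HasDerivAt f (f' t) t) (hg : ∀ t < t₁, HasDerivAt g (g' t) t)
    (hg' : ∀ t < t₁, g' t < 0) (hginf : Tendsto g atBot atTop)
    (hlim : Tendsto (fun t => f' t / g' t) atBot (𝓝 L)) (hc : L < c) :
    ∀ᶠ t in atBot, f t / g t < c := by
  obtain ⟨c', hLc', hc'⟩ := exists_between hc
  obtain ⟨t₂, ht₂⟩ := eventually_atBot.1
    ((hlim.eventually (gt_mem_nhds hLc')).and (eventually_lt_atBot t₁))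
  have hd : ∀ t ∈ Iic t₂, HasDerivAt (fun t => f t - c' * g t) (f' t - c' * g' t) t :=
    fun t ht => (hf t (ht₂ t ht).2).sub ((hg t (ht₂ t ht).2).const_mul c')
  have hmono : MonotoneOn (fun t => f t - c' * g t) (Iic t₂) := by
    refine monotoneOn_of_deriv_nonneg (convex_Iic t₂)
      (fun t ht => (hd t ht).continuousAt.continuousWithinAt)
      (fun t ht => (hd t (interior_subset ht)).differentiableAt.differentiableWithinAt) ?_
    intro t ht
    replace ht : t ∈ Iic t₂ := interior_subset ht
    rw [(hd t ht).deriv]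
    have h1 := ht₂ t ht
    have h2 := (div_lt_iff_of_neg (hg' t h1.2)).1 h1.1
    linarith
  filter_upwards [eventually_le_atBot t₂, hginf.eventually_gt_atTop 0,
    hginf.eventually_gt_atTop ((f t₂ - c' * g t₂) / (c - c'))] with t h1 h2 h3
  have h4 := hmono (show t ∈ Iic t₂ from h1) self_mem_Iic h1
  simp only at h4
  rw [div_lt_iff₀ (sub_pos.2 hc')] at h3
  rw [div_lt_iff₀ h2]
  linarith

theorem tendsto_div_of_deriv_div_atBot {f g f' g' : ℝ → ℝ} {L t₁ : ℝ}
    (hf : ∀ t < t₁, HasDerivAt f (f' t) t) (hg : ∀ t < t₁, HasDerivAt g (g' t) t)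
    (hg' : ∀ t < t₁, g' t < 0) (hginf : Tendsto g atBot atTop)
    (hlim : Tendsto (fun t => f' t / g' t) atBot (𝓝 L)) :
    Tendsto (fun t => f t / g t) atBot (𝓝 L) := by
  refine tendsto_order.2 ⟨fun c hc => ?_, fun c hc =>
    eventually_div_lt_of_deriv_div_atBot hf hg hg' hginf hlim hc⟩
  have := eventually_div_lt_of_deriv_div_atBot (f := fun t => -f t) (f' := fun t => -f' t)
    (fun t ht => (hf t ht).neg) hg hg' hginf
    (by simpa only [neg_div] using hlim.neg) (neg_lt_neg hc)
  filter_upwards [this] with t ht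
  rw [neg_div] at ht
  linarith

/-! ### Conformal time -/

/-- The conformal time `η(t) = -∫_t^{t₀} ds / a(s)`. -/
def conformalTime (a : ℝ → ℝ) (t₀ t : ℝ) : ℝ := ∫ s in t₀..t, 1 / a s

theorem omegaFactor_eq (a : ℝ → ℝ) (h t₀ t : ℝ) :
    omegaFactor a h t₀ t = h * a t * -conformalTime a t₀ t := by
  rw [omegaFactor, conformalTime, intervalIntegral.integral_symm]

section ConformalTime

variable {a : ℝ → ℝ} {tmax t₀ h : ℝ}

theorem hasDerivAt_conformalTime (hc : ContinuousOn a (Iio tmax)) (hpos : ∀ t < tmax, 0 < a t)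
    (ht₀ : t₀ < tmax) {t : ℝ} (ht : t < tmax) :
    HasDerivAt (conformalTime a t₀) (1 / a t) t := by
  have hc' : ContinuousOn (fun s => 1 / a s) (Iio tmax) :=
    continuousOn_const.div hc fun s hs => (hpos s hs).ne'
  refine intervalIntegral.integral_hasDerivAt_right ?_
    (hc'.stronglyMeasurableAtFilter isOpen_Iio t ht) (hc'.continuousAt (Iio_mem_nhds ht))
  exact (hc'.mono ((convex_Iio tmax).ordConnected.uIcc_subset ht₀ ht)).intervalIntegrable

theorem contDiffOn_conformalTime (hc : ContDiffOn ℝ ∞ a (Iio tmax))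
    (hpos : ∀ t < tmax, 0 < a t) (ht₀ : t₀ < tmax) :
    ContDiffOn ℝ ∞ (conformalTime a t₀) (Iio tmax) := by
  have hd := fun t (ht : t < tmax) => hasDerivAt_conformalTime hc.continuousOn hpos ht₀ ht
  rw [contDiffOn_infty_iff_deriv_of_isOpen isOpen_Iio]
  refine ⟨fun t ht => (hd t ht).differentiableAt.differentiableWithinAt, ?_⟩
  refine ContDiffOn.congr (f := fun s => 1 / a s) ?_ fun t ht => (hd t ht).deriv
  exact contDiffOn_const.div hc fun s hs => (hpos s hs).ne'

theorem strictMonoOn_conformalTime (hc : ContinuousOn a (Iio tmax)) (hpos : ∀ t < tmax, 0 < a t)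
    (ht₀ : t₀ < tmax) : StrictMonoOn (conformalTime a t₀) (Iio tmax) := by
  have hd := fun t (ht : t < tmax) => hasDerivAt_conformalTime hc hpos ht₀ ht
  refine strictMonoOn_of_deriv_pos (convex_Iio tmax)
    (fun t ht => (hd t ht).continuousAt.continuousWithinAt) fun t ht => ?_
  replace ht : t ∈ Iio tmax := interior_subset ht
  rw [(hd t ht).deriv]
  exact one_div_pos.2 (hpos t ht)

theorem conformalTime_self : conformalTime a t₀ t₀ = 0 := intervalIntegral.integral_same

theorem conformalTime_neg (hc : ContinuousOn a (Iio tmax)) (hpos : ∀ t < tmax, 0 < a t)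
    (ht₀ : t₀ < tmax) {t : ℝ} (ht : t < t₀) : conformalTime a t₀ t < 0 := by
  simpa only [conformalTime_self] using
    strictMonoOn_conformalTime hc hpos ht₀ (ht.trans ht₀) ht₀ ht

/-- If the Hubble rate tends to `h > 0` then the scale factor tends to zero. -/
theorem tendsto_scaleFactor_of_hubble (hc : DifferentiableOn ℝ a (Iio tmax))
    (hpos : ∀ t < tmax, 0 < a t) (hh : 0 < h)
    (hH : Tendsto (fun t => deriv a t / a t) atBot (𝓝 h)) :
    Tendsto (fun t => (a t)⁻¹) atBot atTop := by
  have hd : ∀ t < tmax, HasDerivAt a (deriv a t) t := fun t ht =>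
    ((hc t ht).differentiableAt (Iio_mem_nhds ht)).hasDerivAt
  have h1 : Tendsto (fun t => -Real.log (a t) / -t) atBot (𝓝 h) :=
    tendsto_div_of_deriv_div_atBot (t₁ := tmax)
      (fun t ht => ((hd t ht).log (hpos t ht).ne').neg) (fun t _ => (hasDerivAt_id t).neg)
      (fun _ _ => by norm_num) tendsto_neg_atBot_atTop (by simpa using hH)
  have h2 : Tendsto (fun t => -Real.log (a t)) atBot atTop := by
    refine (h1.pos_mul_atTop hh tendsto_neg_atBot_atTop).congr' ?_
    filter_upwards [eventually_lt_atBot 0] with t ht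
    exact div_mul_cancel₀ _ (neg_ne_zero.2 ht.ne)
  refine (Real.tendsto_exp_atTop.comp h2).congr' ?_
  filter_upwards [eventually_lt_atBot tmax] with t ht
  simp [Real.exp_neg, Real.exp_log (hpos t ht)]

/-- Either asymptotic condition gives a function `g` tending to infinity with which both `1/a` and
`-hη` are asymptotic. -/
theorem exists_asymptotic_comparison (hc : ContDiffOn ℝ ∞ a (Iio tmax))
    (hpos : ∀ t < tmax, 0 < a t) (ht₀ : t₀ < tmax) (hh : 0 < h)
    (hasymp : (fun t => a t - Real.exp (h * t)) =o[atBot] (fun t => Real.exp (h * t)) ∨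
      Tendsto (fun t => deriv a t / a t) atBot (𝓝 h)) :
    ∃ g : ℝ → ℝ, Tendsto g atBot atTop ∧ Tendsto (fun t => a t * g t) atBot (𝓝 1) ∧
      Tendsto (fun t => -conformalTime a t₀ t / g t) atBot (𝓝 h⁻¹) := by
  have hη := fun t (ht : t < tmax) =>
    (hasDerivAt_conformalTime hc.continuousOn hpos ht₀ ht).neg
  rcases hasymp with hA | hH
  · have h1 : Tendsto (fun t => a t * Real.exp (-(h * t))) atBot (𝓝 1) := by
      have := hA.tendsto_div_nhds_zero.add_const 1
      rw [zero_add] at this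
      refine this.congr fun t => ?_
      rw [Real.exp_neg]
      field_simp
      ring
    have h2 : Tendsto (fun t => Real.exp (-(h * t))) atBot atTop :=
      Real.tendsto_exp_atTop.comp (tendsto_neg_atBot_atTop.comp (tendsto_id.const_mul_atBot hh))
    refine ⟨fun t => Real.exp (-(h * t)), h2, h1, ?_⟩
    refine tendsto_div_of_deriv_div_atBot (t₁ := tmax)
      (g' := fun t => Real.exp (-(h * t)) * -(h * 1)) hη
      (fun t _ => (((hasDerivAt_id t).const_mul h).neg).exp) (fun t _ => ?_) h2 ?_
    · have := mul_pos (Real.exp_pos (-(h * t))) hh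
      linarith
    · have := (h1.inv₀ one_ne_zero).mul_const h⁻¹
      rw [inv_one, one_mul] at this
      refine this.congr fun t => ?_
      rw [mul_one, mul_neg, neg_div_neg_eq, mul_inv, div_div, one_div, mul_inv, mul_inv]
      ring
  · have h2 := tendsto_scaleFactor_of_hubble (hc.differentiableOn (by simp)) hpos hh hH
    have hd : ∀ t < tmax, HasDerivAt a (deriv a t) t := fun t ht =>
      ((hc.differentiableOn (by simp) t ht).differentiableAt (Iio_mem_nhds ht)).hasDerivAt
    obtain ⟨t₂, ht₂⟩ := eventually_atBot.1
      ((hH.eventually (lt_mem_nhds hh)).and (eventually_lt_atBot tmax))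
    refine ⟨fun t => (a t)⁻¹, h2, ?_, ?_⟩
    · refine tendsto_const_nhds.congr' ?_
      filter_upwards [eventually_lt_atBot tmax] with t ht
      exact (mul_inv_cancel₀ (hpos t ht).ne').symm
    · refine tendsto_div_of_deriv_div_atBot (t₁ := t₂) (g' := fun t => -deriv a t / a t ^ 2)
        (fun t ht => hη t (ht₂ t ht.le).2)
        (fun t ht => (hd t (ht₂ t ht.le).2).inv (hpos t (ht₂ t ht.le).2).ne')
        (fun t ht => ?_) h2 ?_
      · have h3 := hpos t (ht₂ t ht.le).2
        have h4 := (div_pos_iff_of_pos_right h3).1 (ht₂ t ht.le).1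
        exact div_neg_of_neg_of_pos (neg_lt_zero.2 h4) (by positivity)
      · refine (hH.inv₀ hh.ne').congr' ?_
        filter_upwards [eventually_le_atBot t₂] with t ht
        have h3 := hpos t (ht₂ t ht).2
        have h4 := (div_pos_iff_of_pos_right h3).1 (ht₂ t ht).1
        field_simp

theorem tendsto_conformalTime (hc : ContDiffOn ℝ ∞ a (Iio tmax))
    (hpos : ∀ t < tmax, 0 < a t) (ht₀ : t₀ < tmax) (hh : 0 < h)
    (hasymp : (fun t => a t - Real.exp (h * t)) =o[atBot] (fun t => Real.exp (h * t)) ∨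
      Tendsto (fun t => deriv a t / a t) atBot (𝓝 h)) :
    Tendsto (conformalTime a t₀) atBot atBot := by
  obtain ⟨g, hg, -, hgη⟩ := exists_asymptotic_comparison hc hpos ht₀ hh hasymp
  have h1 : Tendsto (fun t => -conformalTime a t₀ t) atBot atTop := by
    refine (hgη.pos_mul_atTop (inv_pos.2 hh) hg).congr' ?_
    filter_upwards [hg.eventually_gt_atTop 0] with t ht
    field_simp
  simpa [Function.comp_def] using tendsto_neg_atTop_atBot.comp h1

theorem tendsto_scaleFactor_mul_conformalTime (hc : ContDiffOn ℝ ∞ a (Iio tmax))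
    (hpos : ∀ t < tmax, 0 < a t) (ht₀ : t₀ < tmax) (hh : 0 < h)
    (hasymp : (fun t => a t - Real.exp (h * t)) =o[atBot] (fun t => Real.exp (h * t)) ∨
      Tendsto (fun t => deriv a t / a t) atBot (𝓝 h)) :
    Tendsto (fun t => a t * -conformalTime a t₀ t) atBot (𝓝 h⁻¹) := by
  obtain ⟨g, hg, hga, hgη⟩ := exists_asymptotic_comparison hc hpos ht₀ hh hasymp
  have := hga.mul hgη
  rw [one_mul] at this
  refine this.congr' ?_
  filter_upwards [hg.eventually_gt_atTop 0] with t ht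
  field_simp

/-- The conformal time has a continuous inverse on `(-∞, 0]`. -/
theorem exists_inverse_conformalTime (hc : ContinuousOn a (Iio tmax))
    (hpos : ∀ t < tmax, 0 < a t) (ht₀ : t₀ < tmax)
    (hlim : Tendsto (conformalTime a t₀) atBot atBot) :
    ∃ s : ℝ → ℝ, Continuous s ∧ (∀ y, s y ≤ t₀) ∧ (∀ y ≤ 0, conformalTime a t₀ (s y) = y) ∧
      (∀ t ≤ t₀, s (conformalTime a t₀ t) = t) ∧ Tendsto s atBot atBot := by
  have hsub : Iic t₀ ⊆ Iio tmax := Iic_subset_Iio.2 ht₀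
  have hmono := (strictMonoOn_conformalTime hc hpos ht₀).mono hsub
  have hcont : ContinuousOn (conformalTime a t₀) (Iic t₀) := fun t ht =>
    (hasDerivAt_conformalTime hc hpos ht₀ (hsub ht)).continuousAt.continuousWithinAt
  have hle : ∀ t : Iic t₀, conformalTime a t₀ t ∈ Iic (0 : ℝ) := fun t => by
    rw [mem_Iic]
    simpa only [conformalTime_self] using hmono.monotoneOn t.2 self_mem_Iic t.2
  let e : Iic t₀ ≃o Iic (0 : ℝ) := StrictMono.orderIsoOfSurjective
    (fun t => ⟨conformalTime a t₀ t, hle t⟩) (fun t t' htt' => hmono t.2 t'.2 htt') (by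
      rintro ⟨y, hy⟩
      obtain ⟨t₁, ht₁⟩ := eventually_atBot.1
        ((hlim.eventually_le_atBot y).and (eventually_le_atBot t₀))
      obtain ⟨h1, h2⟩ := ht₁ t₁ le_rfl
      obtain ⟨t, ht, hty⟩ := intermediate_value_Icc h2 (hcont.mono Icc_subset_Iic_self)
        ⟨h1, by rw [conformalTime_self]; exact hy⟩
      exact ⟨⟨t, ht.2⟩, Subtype.ext hty⟩)
  have he : ∀ t, (e t : ℝ) = conformalTime a t₀ t := fun _ => rfl
  have hinv : ∀ t ≤ t₀, (e.symm ⟨min (conformalTime a t₀ t) 0, mem_Iic.2 (min_le_right _ _)⟩ : ℝ) = t := by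
    intro t ht
    have : (⟨min (conformalTime a t₀ t) 0, mem_Iic.2 (min_le_right _ _)⟩ : Iic (0 : ℝ)) = e ⟨t, ht⟩ :=
      Subtype.ext (min_eq_left (hle ⟨t, ht⟩))
    rw [this, e.symm_apply_apply]
  refine ⟨fun y => e.symm ⟨min y 0, mem_Iic.2 (min_le_right _ _)⟩, ?_, fun y => (e.symm _).2, fun y hy => ?_,
    hinv, ?_⟩
  · exact continuous_subtype_val.comp (e.symm.continuous.comp
      ((continuous_id.min continuous_const).subtype_mk _))
  · rw [← he, e.apply_symm_apply]
    exact min_eq_left hy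
  · refine tendsto_atBot.2 fun b => ?_
    filter_upwards [eventually_le_atBot (conformalTime a t₀ (min b t₀))] with y hy
    refine le_trans ?_ (min_le_left b t₀)
    rw [← hinv (min b t₀) (min_le_right _ _)]
    exact e.symm.monotone (Subtype.mk_le_mk.2 (min_le_min_right 0 hy))

end ConformalTime

/-! ### A homogeneous function on the quadrant -/

/-- The function on the quadrant `u, v ≥ 0`, homogeneous of degree one, that is `v b(-u/v)` off the
axis `v = 0` and `h u` on it. -/
def homogeneousExtension (b : ℝ → ℝ) (h u v : ℝ) : ℝ := if 0 < v then v * b (-u / v) else h * u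

theorem continuousOn_homogeneousExtension {b : ℝ → ℝ} {h : ℝ} (hb : Continuous b)
    (hlim : Tendsto (fun y => b y / -y) atBot (𝓝 h)) :
    ContinuousOn (fun p : ℝ × ℝ => homogeneousExtension b h p.1 p.2) {p | 0 ≤ p.1 ∧ 0 ≤ p.2} := by
  rintro ⟨u, v⟩ ⟨hu, hv⟩
  simp only at hu hv
  rcases hv.lt_or_eq with hv | rfl
  · have h1 : ContinuousAt (fun p : ℝ × ℝ => p.2 * b (-p.1 / p.2)) (u, v) := by
      refine continuousAt_snd.mul (hb.continuousAt.comp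
        (continuousAt_fst.neg.div continuousAt_snd hv.ne'))
    refine (h1.congr ?_).continuousWithinAt
    filter_upwards [continuousAt_snd.eventually (lt_mem_nhds hv)] with p hp
    exact (if_pos hp).symm
  rcases hu.lt_or_eq with hu | rfl
  · have h0 : homogeneousExtension b h u 0 = h * u := if_neg (lt_irrefl _)
    rw [ContinuousWithinAt, h0]
    have key : Tendsto (fun p : ℝ × ℝ => homogeneousExtension b h p.1 p.2 / p.1)
        (𝓝[{p | 0 ≤ p.1 ∧ 0 ≤ p.2}] (u, 0)) (𝓝 h) := by
      refine tendsto_def.2 fun U hU => ?_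
      obtain ⟨N, hN⟩ := eventually_atBot.1 (hlim hU)
      set K := max (-N) 1 with hK
      have hK0 : 0 < K := lt_max_of_lt_right one_pos
      have h2 : ∀ᶠ p : ℝ × ℝ in 𝓝 (u, 0), 0 < p.1 ∧ 0 < p.1 - K * p.2 := by
        refine (continuousAt_fst.eventually (lt_mem_nhds hu)).and ?_
        have : ContinuousAt (fun p : ℝ × ℝ => p.1 - K * p.2) (u, 0) := by fun_prop
        exact this.eventually (lt_mem_nhds (by simpa using hu))
      filter_upwards [h2.filter_mono nhdsWithin_le_nhds, self_mem_nhdsWithin] with p hp hq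
      rw [mem_preimage, homogeneousExtension]
      split_ifs with hv
      · have h3 : -p.1 / p.2 ≤ N := by
          rw [div_le_iff₀ hv]
          nlinarith [le_max_left (-N) 1, hp.2]
        have h4 := hN _ h3
        convert h4 using 1
        have := hp.1.ne'
        field_simp
      · rw [mul_div_cancel_right₀ _ hp.1.ne']
        exact mem_of_mem_nhds hU
    have h3 := key.mul ((continuousAt_fst (p := ((u : ℝ), (0 : ℝ)))).tendsto.mono_left
      (nhdsWithin_le_nhds (s := {p : ℝ × ℝ | 0 ≤ p.1 ∧ 0 ≤ p.2})))
    refine h3.congr' ?_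
    have h4 : ∀ᶠ p : ℝ × ℝ in 𝓝 (u, 0), 0 < p.1 :=
      continuousAt_fst.eventually (lt_mem_nhds hu)
    filter_upwards [h4.filter_mono nhdsWithin_le_nhds] with p hp
    exact div_mul_cancel₀ _ hp.ne'
  · obtain ⟨N, hN⟩ := eventually_atBot.1 ((hlim.abs.eventually
      (gt_mem_nhds (lt_add_one |h|))).and (eventually_lt_atBot 0))
    obtain ⟨C, hC⟩ := (isCompact_Icc (a := N) (b := 0)).exists_bound_of_continuousOn
      hb.continuousOn
    have h0 : homogeneousExtension b h 0 0 = 0 := by simp [homogeneousExtension]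
    rw [ContinuousWithinAt, h0]
    have h1 : Tendsto (fun p : ℝ × ℝ => (|h| + 1) * p.1 + |C| * p.2)
        (𝓝[{p | 0 ≤ p.1 ∧ 0 ≤ p.2}] (0, 0)) (𝓝 0) := by
      have : Continuous (fun p : ℝ × ℝ => (|h| + 1) * p.1 + |C| * p.2) := by fun_prop
      simpa using (this.tendsto (0, 0)).mono_left nhdsWithin_le_nhds
    refine squeeze_zero_norm' ?_ h1
    filter_upwards [self_mem_nhdsWithin] with p hp
    have hC0 := mul_nonneg (abs_nonneg C) hp.2
    have hh0 := mul_nonneg (add_nonneg (abs_nonneg h) zero_le_one) hp.1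
    rw [homogeneousExtension]
    split_ifs with hv
    · rw [norm_mul, Real.norm_eq_abs, abs_of_pos hv]
      have hy : -p.1 / p.2 ≤ 0 := div_nonpos_of_nonpos_of_nonneg (neg_nonpos.2 hp.1) hv.le
      rcases le_or_gt (-p.1 / p.2) N with hle | hgt
      · obtain ⟨h2, h3⟩ := hN _ hle
        rw [abs_div, div_lt_iff₀ (abs_pos.2 (neg_ne_zero.2 h3.ne)), abs_of_pos (neg_pos.2 h3)] at h2
        have h4 := mul_le_mul_of_nonneg_left h2.le hv.le
        have h5 : p.2 * ((|h| + 1) * -(-p.1 / p.2)) = (|h| + 1) * p.1 := by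
          field_simp
        rw [h5] at h4
        rw [Real.norm_eq_abs]
        linarith
      · have h2 := mul_le_mul_of_nonneg_left ((hC _ ⟨hgt.le, hy⟩).trans (le_abs_self C)) hv.le
        linarith
    · rw [norm_mul, Real.norm_eq_abs, Real.norm_eq_abs, abs_of_nonneg hp.1]
      linarith [hp.1]

/-! ### The half Minkowski space in the Einstein static universe -/

/-- The isometry `ℝ × ℝ³ → ℝ⁴`. -/
def consCLM : ℝ × EuclideanSpace ℝ (Fin 3) →L[ℝ] EuclideanSpace ℝ (Fin 4) :=
  LinearMap.toContinuousLinearMap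
    { toFun := fun p => !₂[p.1, p.2 0, p.2 1, p.2 2]
      map_add' := fun p p' => by ext i; fin_cases i <;> simp
      map_smul' := fun c p => by ext i; fin_cases i <;> simp }

theorem consCLM_apply (p : ℝ × EuclideanSpace ℝ (Fin 3)) :
    consCLM p = !₂[p.1, p.2 0, p.2 1, p.2 2] := rfl

@[simp] theorem consCLM_apply_zero (p : ℝ × EuclideanSpace ℝ (Fin 3)) : consCLM p 0 = p.1 := rfl

theorem inner_consCLM (p p' : ℝ × EuclideanSpace ℝ (Fin 3)) :
    inner ℝ (consCLM p) (consCLM p') = p.1 * p'.1 + inner ℝ p.2 p'.2 := by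
  simp only [consCLM_apply, PiLp.inner_apply, Fin.sum_univ_four, Fin.sum_univ_three]
  simp
  ring

/-- The last three coordinates of a vector of `ℝ⁴`. -/
def tailVec (q : EuclideanSpace ℝ (Fin 4)) : EuclideanSpace ℝ (Fin 3) := !₂[q 1, q 2, q 3]

theorem continuous_tailVec : Continuous tailVec :=
  (PiLp.continuous_toLp 2 _).comp (continuous_pi fun i => by
    fin_cases i <;> simp <;> fun_prop)

theorem consCLM_tailVec (q : EuclideanSpace ℝ (Fin 4)) : consCLM (q 0, tailVec q) = q := by
  ext i
  fin_cases i <;> rfl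

theorem tailVec_consCLM (p : ℝ × EuclideanSpace ℝ (Fin 3)) : tailVec (consCLM p) = p.2 := by
  ext i
  fin_cases i <;> rfl

theorem tailVec_smul (c : ℝ) (q : EuclideanSpace ℝ (Fin 4)) :
    tailVec (c • q) = c • tailVec q := by
  ext i
  fin_cases i <;> rfl

theorem norm_sq_eq_tailVec (q : EuclideanSpace ℝ (Fin 4)) :
    ‖q‖ ^ 2 = q 0 ^ 2 + ‖tailVec q‖ ^ 2 := by
  rw [← real_inner_self_eq_norm_sq, ← real_inner_self_eq_norm_sq]
  conv_lhs => rw [← consCLM_tailVec q, inner_consCLM]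
  ring

/-- The squared denominator in the embedding of the half Minkowski space in the Einstein static
universe. -/
def flatDenom (p : ℝ × EuclideanSpace ℝ (Fin 3)) : ℝ :=
  (1 - p.1 ^ 2 + ‖p.2‖ ^ 2) ^ 2 + 4 * p.1 ^ 2

/-- The conformal factor from the half Minkowski space to the Einstein static universe. -/
def flatFactor (p : ℝ × EuclideanSpace ℝ (Fin 3)) : ℝ := 2 / √(flatDenom p)

/-- The time coordinate of the Einstein static universe on the half Minkowski space. -/
def esuTime (p : ℝ × EuclideanSpace ℝ (Fin 3)) : ℝ :=
  Real.arctan ((1 - p.1 ^ 2 + ‖p.2‖ ^ 2) / (-2 * p.1))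

/-- The `𝕊³` coordinate of the Einstein static universe on the half Minkowski space. -/
def esuVec (p : ℝ × EuclideanSpace ℝ (Fin 3)) : EuclideanSpace ℝ (Fin 4) :=
  flatFactor p • consCLM ((1 + p.1 ^ 2 - ‖p.2‖ ^ 2) / 2, p.2)

section HalfMinkowski

variable {p : ℝ × EuclideanSpace ℝ (Fin 3)}

theorem flatDenom_pos : 0 < flatDenom p := by
  rw [flatDenom]
  rcases eq_or_ne p.1 0 with h | h
  · rw [h]
    positivity
  · positivity

theorem flatFactor_pos : 0 < flatFactor p := div_pos two_pos (Real.sqrt_pos.2 flatDenom_pos)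

theorem flatFactor_sq : flatFactor p ^ 2 * flatDenom p = 4 := by
  rw [flatFactor, div_pow, Real.sq_sqrt flatDenom_pos.le, div_mul_cancel₀ _ flatDenom_pos.ne']
  norm_num

theorem norm_esuVec : ‖esuVec p‖ = 1 := by
  have h : ‖esuVec p‖ ^ 2 = 1 := by
    rw [esuVec, ← real_inner_self_eq_norm_sq, real_inner_smul_left, real_inner_smul_right,
      inner_consCLM, real_inner_self_eq_norm_sq]
    have := flatFactor_sq (p := p)
    rw [flatDenom] at this
    linear_combination this / 4
  exact (sq_eq_sq₀ (norm_nonneg _) zero_le_one).1 (by rw [h, one_pow])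

theorem esuTime_mem : esuTime p ∈ Ioo (-(Real.pi / 2)) (Real.pi / 2) := Real.arctan_mem_Ioo _

theorem cos_esuTime (hp : p.1 < 0) : Real.cos (esuTime p) = -flatFactor p * p.1 := by
  have hD := flatDenom_pos (p := p)
  rw [esuTime, Real.cos_arctan, flatFactor]
  have h1 : 1 + ((1 - p.1 ^ 2 + ‖p.2‖ ^ 2) / (-2 * p.1)) ^ 2 = flatDenom p / (-2 * p.1) ^ 2 := by
    have := hp.ne
    rw [flatDenom]
    field_simp
    ring
  rw [h1, Real.sqrt_div hD.le, Real.sqrt_sq (by linarith)]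
  field_simp

theorem sin_esuTime (hp : p.1 < 0) :
    Real.sin (esuTime p) = flatFactor p * ((1 - p.1 ^ 2 + ‖p.2‖ ^ 2) / 2) := by
  have h1 : Real.cos (esuTime p) ≠ 0 := (Real.cos_pos_of_mem_Ioo esuTime_mem).ne'
  have h2 : Real.tan (esuTime p) = (1 - p.1 ^ 2 + ‖p.2‖ ^ 2) / (-2 * p.1) := Real.tan_arctan _
  rw [Real.tan_eq_sin_div_cos, div_eq_iff h1, cos_esuTime hp] at h2
  have := hp.ne
  rw [h2]
  field_simp

theorem sin_esuTime_add (hp : p.1 < 0) : Real.sin (esuTime p) + esuVec p 0 = flatFactor p := by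
  rw [sin_esuTime hp, esuVec, PiLp.smul_apply, consCLM_apply_zero, smul_eq_mul]
  ring

theorem tailVec_esuVec : tailVec (esuVec p) = flatFactor p • p.2 := by
  rw [esuVec, tailVec_smul, tailVec_consCLM]

/-- The half Minkowski space covers the region `-π/2 < T' < π/2`, `sin T' + q₀ > 0`. -/
theorem exists_esu_eq {T : ℝ} {q : EuclideanSpace ℝ (Fin 4)} (hq : ‖q‖ = 1)
    (hT : T ∈ Ioo (-(Real.pi / 2)) (Real.pi / 2)) (hpos : 0 < Real.sin T + q 0) :
    ∃ p : ℝ × EuclideanSpace ℝ (Fin 3), p.1 < 0 ∧ esuTime p = T ∧ esuVec p = q := by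
  have hc := Real.cos_pos_of_mem_Ioo hT
  set l := Real.sin T + q 0 with hl
  have hp : -Real.cos T / l < 0 := div_neg_of_neg_of_pos (neg_lt_zero.2 hc) hpos
  have hq2 : ‖tailVec q‖ ^ 2 = 1 - q 0 ^ 2 := by
    have := norm_sq_eq_tailVec q
    rw [hq] at this
    linarith
  have hr : ‖l⁻¹ • tailVec q‖ ^ 2 = (1 - q 0 ^ 2) / l ^ 2 := by
    rw [norm_smul, mul_pow, hq2, norm_inv, Real.norm_eq_abs, inv_pow, sq_abs]
    ring
  set P : ℝ × EuclideanSpace ℝ (Fin 3) := (-Real.cos T / l, l⁻¹ • tailVec q) with hP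
  have hTP : esuTime P = T := by
    rw [esuTime, hP, hr, ← Real.arctan_tan hT.1 hT.2, Real.tan_eq_sin_div_cos]
    congr 1
    rw [Real.arctan_eq_of_tan_eq (y := Real.sin T / Real.cos T)
      (Real.tan_eq_sin_div_cos T) hT]
    have h1 := Real.sin_sq_add_cos_sq T
    rw [hl] at hpos ⊢
    field_simp
    linear_combination (-1) * h1
  have hlP : flatFactor P = l := by
    have h1 : Real.cos T = -flatFactor P * (-Real.cos T / l) := by
      simpa only [hTP] using cos_esuTime (p := P) hp
    have h2 := hpos.ne'
    field_simp at h1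
    linarith
  refine ⟨P, hp, hTP, ?_⟩
  have h0 : esuVec P 0 = q 0 := by
    have h1 := sin_esuTime_add (p := P) hp
    rw [hTP, hlP] at h1
    linarith
  have h1 : tailVec (esuVec P) = tailVec q := by
    rw [tailVec_esuVec, hlP]
    exact smul_inv_smul₀ hpos.ne' _
  rw [← consCLM_tailVec q, ← consCLM_tailVec (esuVec P), h0, h1]

theorem contDiff_flatDenom : ContDiff ℝ ∞ flatDenom := by
  have h : ContDiff ℝ ∞ (fun p : ℝ × EuclideanSpace ℝ (Fin 3) => ‖p.2‖ ^ 2) :=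
    contDiff_snd.norm_sq ℝ
  have h1 : ContDiff ℝ ∞ (fun p : ℝ × EuclideanSpace ℝ (Fin 3) => p.1) := contDiff_fst
  exact ((((contDiff_const.sub (h1.pow 2)).add h).pow 2).add (contDiff_const.mul (h1.pow 2)))

theorem contDiff_flatFactor : ContDiff ℝ ∞ flatFactor :=
  contDiff_const.div (contDiff_flatDenom.sqrt fun _ => flatDenom_pos.ne')
    fun _ => (Real.sqrt_pos.2 flatDenom_pos).ne'

theorem contDiff_esuVec : ContDiff ℝ ∞ esuVec := by
  have h : ContDiff ℝ ∞ (fun p : ℝ × EuclideanSpace ℝ (Fin 3) => ‖p.2‖ ^ 2) :=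
    contDiff_snd.norm_sq ℝ
  have h1 : ContDiff ℝ ∞ (fun p : ℝ × EuclideanSpace ℝ (Fin 3) => p.1) := contDiff_fst
  exact contDiff_flatFactor.smul (consCLM.contDiff.comp
    ((((contDiff_const.add (h1.pow 2)).sub h).div_const 2).prodMk contDiff_snd))

theorem contDiffAt_esuTime (hp : p.1 < 0) : ContDiffAt ℝ ∞ esuTime p := by
  have h : ContDiff ℝ ∞ (fun p : ℝ × EuclideanSpace ℝ (Fin 3) => ‖p.2‖ ^ 2) :=
    contDiff_snd.norm_sq ℝ
  have h1 : ContDiff ℝ ∞ (fun p : ℝ × EuclideanSpace ℝ (Fin 3) => p.1) := contDiff_fst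
  exact (((contDiff_const.sub (h1.pow 2)).add h).contDiffAt.div
    (contDiff_const.mul h1).contDiffAt (by simpa using hp.ne)).arctan

theorem hasFDerivAt_norm_sq_snd (p : ℝ × EuclideanSpace ℝ (Fin 3)) :
    HasFDerivAt (fun p : ℝ × EuclideanSpace ℝ (Fin 3) => ‖p.2‖ ^ 2)
      (2 • (innerSL ℝ p.2).comp (ContinuousLinearMap.snd ℝ ℝ (EuclideanSpace ℝ (Fin 3)))) p := by
  exact (hasFDerivAt_snd (𝕜 := ℝ) (p := p)).norm_sq

theorem fderiv_esuVec_apply (v : ℝ × EuclideanSpace ℝ (Fin 3)) :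
    fderiv ℝ esuVec p v =
      fderiv ℝ flatFactor p v • consCLM ((1 + p.1 ^ 2 - ‖p.2‖ ^ 2) / 2, p.2) +
        flatFactor p • consCLM (p.1 * v.1 - inner ℝ p.2 v.2, v.2) := by
  have h0 : HasFDerivAt flatFactor (fderiv ℝ flatFactor p) p :=
    ((contDiff_flatFactor.differentiable (by simp)) p).hasFDerivAt
  have h1 := ((((hasFDerivAt_fst (𝕜 := ℝ) (p := p)).pow 2).const_add 1).sub
    (hasFDerivAt_norm_sq_snd p)).mul_const (2 : ℝ)⁻¹
  have h2 := h0.smul (consCLM.hasFDerivAt.comp p (h1.prodMk (hasFDerivAt_snd (𝕜 := ℝ) (p := p))))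
  have h3 : HasFDerivAt esuVec _ p := h2
  rw [h3.fderiv]
  simp only [add_apply, smul_apply,
    ContinuousLinearMap.comp_apply, ContinuousLinearMap.smulRight_apply, Function.comp]
  rw [add_comm]
  congr 3
  refine Prod.ext ?_ rfl
  simp
  ring

theorem fderiv_esuTime_apply (hp : p.1 < 0) (v : ℝ × EuclideanSpace ℝ (Fin 3)) :
    Real.sin (esuTime p) * fderiv ℝ esuTime p v =
      fderiv ℝ flatFactor p v * p.1 + flatFactor p * v.1 ∧
    Real.cos (esuTime p) * fderiv ℝ esuTime p v =
      fderiv ℝ flatFactor p v * ((1 - p.1 ^ 2 + ‖p.2‖ ^ 2) / 2) +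
        flatFactor p * (-(p.1 * v.1) + inner ℝ p.2 v.2) := by
  have h0 : HasFDerivAt flatFactor (fderiv ℝ flatFactor p) p :=
    ((contDiff_flatFactor.differentiable (by simp)) p).hasFDerivAt
  have hT : HasFDerivAt esuTime (fderiv ℝ esuTime p) p :=
    ((contDiffAt_esuTime hp).differentiableAt (by simp)).hasFDerivAt
  have h1 := ((((hasFDerivAt_fst (𝕜 := ℝ) (p := p)).pow 2).const_sub 1).add
    (hasFDerivAt_norm_sq_snd p)).mul_const (2 : ℝ)⁻¹
  have hev : ∀ᶠ p' : ℝ × EuclideanSpace ℝ (Fin 3) in 𝓝 p, p'.1 < 0 :=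
    continuousAt_fst.eventually (gt_mem_nhds hp)
  constructor
  · have h2 := hT.cos.unique (((h0.neg.mul (hasFDerivAt_fst (𝕜 := ℝ) (p := p)))).congr_of_eventuallyEq
      (hev.mono fun p' hp' => cos_esuTime hp'))
    have h3 := congrArg (fun L => L v) h2
    simp at h3
    linarith
  · have h2 := hT.sin.unique ((h0.mul h1).congr_of_eventuallyEq
      (hev.mono fun p' hp' => sin_esuTime hp'))
    have h3 := congrArg (fun L => L v) h2
    simp at h3
    linarith

/-- The embedding of the half Minkowski space in the Einstein static universe is conformal. -/
theorem esu_pullback (hp : p.1 < 0) (v w : ℝ × EuclideanSpace ℝ (Fin 3)) :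
    -(fderiv ℝ esuTime p v * fderiv ℝ esuTime p w) +
      inner ℝ (fderiv ℝ esuVec p v) (fderiv ℝ esuVec p w) =
    flatFactor p ^ 2 * (-(v.1 * w.1) + inner ℝ v.2 w.2) := by
  obtain ⟨hv1, hv2⟩ := fderiv_esuTime_apply hp v
  obtain ⟨hw1, hw2⟩ := fderiv_esuTime_apply hp w
  have h1 : fderiv ℝ esuTime p v * fderiv ℝ esuTime p w =
      (Real.sin (esuTime p) * fderiv ℝ esuTime p v) *
        (Real.sin (esuTime p) * fderiv ℝ esuTime p w) +
      (Real.cos (esuTime p) * fderiv ℝ esuTime p v) *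
        (Real.cos (esuTime p) * fderiv ℝ esuTime p w) := by
    linear_combination (-(fderiv ℝ esuTime p v * fderiv ℝ esuTime p w)) *
      Real.sin_sq_add_cos_sq (esuTime p)
  rw [h1, hv1, hv2, hw1, hw2, fderiv_esuVec_apply, fderiv_esuVec_apply]
  simp only [inner_add_left, inner_add_right, real_inner_smul_left, real_inner_smul_right,
    inner_consCLM]
  simp only [real_inner_self_eq_norm_sq, real_inner_comm p.2 v.2]
  ring

end HalfMinkowski

/-! ### Timelike curves in the Einstein static universe -/

theorem lt_of_forall_eventually_nhdsGT_lt {g : ℝ → ℝ} {a b : ℝ} (hab : a < b)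
    (hg : ContinuousOn g (Icc a b)) (h : ∀ u ∈ Ico a b, ∀ᶠ w in 𝓝[>] u, g u < g w) :
    g a < g b := by
  have key : ∀ u ∈ Ico a b, ¬IsMaxOn g (Icc a b) u := fun u hu hmax => by
    obtain ⟨w, hw, hwb⟩ := ((h u hu).and (Ioc_mem_nhdsGT hu.2)).exists
    exact hw.not_ge (hmax ⟨hu.1.trans hwb.1.le, hwb.2⟩)
  obtain ⟨u, hu, hmax⟩ := isCompact_Icc.exists_isMaxOn (nonempty_Icc.2 hab.le) hg
  have hub : u = b := by
    by_contra hne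
    exact key u ⟨hu.1, lt_of_le_of_ne hu.2 hne⟩ hmax
  subst hub
  by_contra hle
  exact key a ⟨le_rfl, hab⟩ fun x hx => (hmax hx).trans (not_lt.1 hle)

theorem norm_S3 (q : S3) : ‖(q : EuclideanSpace ℝ (Fin 4))‖ = 1 := norm_eq_of_mem_sphere q

namespace EinsteinStatic

open InnerProductGeometry

theorem northPole_coe : ((northPole : S3) : EuclideanSpace ℝ (Fin 4)) = consCLM (1, 0) := by
  ext i
  fin_cases i <;> simp [northPole, consCLM_apply]

theorem inner_northPole (q : EuclideanSpace ℝ (Fin 4)) :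
    inner ℝ ((northPole : S3) : EuclideanSpace ℝ (Fin 4)) q = q 0 := by
  rw [northPole, EuclideanSpace.inner_single_left]
  simp

theorem chi_eq_angle (q : S3) :
    chi q = angle ((northPole : S3) : EuclideanSpace ℝ (Fin 4)) (q : EuclideanSpace ℝ (Fin 4)) := by
  rw [angle, norm_S3, norm_S3, inner_northPole, chi, mul_one, div_one]

theorem chi_le_add_angle (q q' : S3) :
    chi q' ≤ chi q + angle (q : EuclideanSpace ℝ (Fin 4)) (q' : EuclideanSpace ℝ (Fin 4)) := by
  rw [chi_eq_angle, chi_eq_angle]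
  exact angle_le_angle_add_angle _ _ _

theorem continuous_chi : Continuous chi := by
  unfold chi
  fun_prop

theorem cos_chi (q : S3) : Real.cos (chi q) = q.1 0 := by
  rw [chi_eq_angle, cos_angle, inner_northPole, norm_S3, norm_S3, mul_one, div_one]

theorem chi_northPole : chi northPole = 0 := by simp [chi, northPole]

theorem chi_southPole : chi southPole = Real.pi := by simp [chi, southPole, northPole]

theorem chi_nonneg (q : S3) : 0 ≤ chi q := Real.arccos_nonneg _

theorem chi_le_pi (q : S3) : chi q ≤ Real.pi := Real.arccos_le_pi _

/-- If the `𝕊³` speed is less than the time speed, then the angle travelled is less than the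
elapsed time. -/
theorem eventually_angle_lt {T : ℝ → ℝ} {c : ℝ → EuclideanSpace ℝ (Fin 4)} (hc : ∀ u, ‖c u‖ = 1)
    {T' : ℝ} {c' : EuclideanSpace ℝ (Fin 4)} {u : ℝ} (hT : HasDerivWithinAt T T' (Ioi u) u)
    (hcd : HasDerivWithinAt c c' (Ioi u) u) (hlt : ‖c'‖ < T') :
    ∀ᶠ w in 𝓝[>] u, angle (c u) (c w) < T w - T u := by
  rw [hasDerivWithinAt_iff_tendsto_slope' self_notMem_Ioi] at hT hcd
  have hT0 : 0 < T' := (norm_nonneg _).trans_lt hlt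
  have hε : Tendsto (fun w => w - u) (𝓝[>] u) (𝓝 0) := by
    have : ContinuousAt (fun w => w - u) u := by fun_prop
    simpa using this.tendsto.mono_left (nhdsWithin_le_nhds (s := Ioi u))
  have hδ : Tendsto (fun w => (w - u) * slope T u w) (𝓝[>] u) (𝓝 0) := by
    simpa using hε.mul hT
  have hlim : Tendsto (fun w => slope T u w ^ 2 * (1 - ((w - u) * slope T u w) ^ 2 * (5 / 48)) -
      ‖slope c u w‖ ^ 2) (𝓝[>] u) (𝓝 (T' ^ 2 * (1 - 0 ^ 2 * (5 / 48)) - ‖c'‖ ^ 2)) :=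
    ((hT.pow 2).mul (((hδ.pow 2).mul_const _).const_sub 1)).sub (hcd.norm.pow 2)
  have hpos : 0 < T' ^ 2 * (1 - 0 ^ 2 * (5 / 48)) - ‖c'‖ ^ 2 := by
    have := pow_lt_pow_left₀ hlt (norm_nonneg _) two_ne_zero
    linarith
  filter_upwards [hlim.eventually (lt_mem_nhds hpos), hT.eventually (lt_mem_nhds hT0),
    hδ.eventually (gt_mem_nhds one_pos), self_mem_nhdsWithin] with w h1 h2 h3 h4
  have hw : 0 < w - u := sub_pos.2 h4
  have hTw : (w - u) * slope T u w = T w - T u := by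
    rw [slope_def_field]
    field_simp
  have hcw : c w - c u = (w - u) • slope c u w := by
    rw [slope, vsub_eq_sub, smul_inv_smul₀ hw.ne']
  have hcn : ‖c w - c u‖ ^ 2 = (w - u) ^ 2 * ‖slope c u w‖ ^ 2 := by
    rw [hcw, norm_smul, mul_pow, Real.norm_eq_abs, sq_abs]
  have hδ0 : 0 < T w - T u := hTw ▸ mul_pos hw h2
  rw [hTw] at h1 h3
  have h5 : ‖c w - c u‖ ^ 2 < (T w - T u) ^ 2 * (1 - (T w - T u) ^ 2 * (5 / 48)) := by
    have := mul_pos (pow_pos hw 2) h1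
    rw [hcn]
    rw [← hTw] at this ⊢
    linarith
  have h6 : inner ℝ (c u) (c w) = 1 - ‖c w - c u‖ ^ 2 / 2 := by
    rw [norm_sub_sq_real, hc, hc, real_inner_comm]
    ring
  have h7 := (abs_le.1 (Real.cos_bound (x := T w - T u) (abs_le.2 ⟨by linarith, h3.le⟩))).2
  rw [abs_of_pos hδ0] at h7
  by_contra hle
  have h8 := Real.cos_le_cos_of_nonneg_of_le_pi hδ0.le (angle_le_pi (c u) (c w)) (not_lt.1 hle)
  rw [cos_angle, hc, hc, mul_one, div_one, h6] at h8
  linarith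

end EinsteinStatic

section Curves

variable {k : ℕ∞}

theorem einsteinStatic_isFutureTimelike_iff (x : ℝ × S3)
    (v : TangentSpace (𝓘(ℝ, ℝ).prod (𝓡 3)) x) :
    (einsteinStatic k).IsFutureTimelike x v ↔
      ‖mvfderiv (𝓘(ℝ, ℝ).prod (𝓡 3)) (fun p : ℝ × S3 => (p.2 : EuclideanSpace ℝ (Fin 4))) x v‖ <
        mvfderiv (𝓘(ℝ, ℝ).prod (𝓡 3)) (Prod.fst : ℝ × S3 → ℝ) x v := by
  have h1 : mvfderiv (𝓘(ℝ, ℝ).prod (𝓡 3)) (Prod.fst : ℝ × S3 → ℝ) x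
      ((einsteinStatic k).timeField x) = 1 := mvfderiv_esu_time x _
  have h2 : mvfderiv (𝓘(ℝ, ℝ).prod (𝓡 3)) (fun p : ℝ × S3 => (p.2 : EuclideanSpace ℝ (Fin 4))) x
      ((einsteinStatic k).timeField x) = 0 := (mvfderiv_esu_space x _).trans (map_zero _)
  change warpedForm _ _ _ _ _ _ _ < 0 ∧ warpedForm _ _ _ _ _ _ _ < 0 ↔ _
  rw [warpedForm_apply, warpedForm_apply, h1, h2, inner_zero_right, real_inner_self_eq_norm_sq]
  constructor
  · rintro ⟨h3, h4⟩
    refine lt_of_pow_lt_pow_left₀ 2 (by linarith) (by linarith)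
  · intro h3
    have h4 := pow_lt_pow_left₀ h3 (norm_nonneg _) two_ne_zero
    have h5 := (norm_nonneg _).trans_lt h3
    constructor <;> linarith

theorem einsteinStatic_isPastTimelike_iff (x : ℝ × S3)
    (v : TangentSpace (𝓘(ℝ, ℝ).prod (𝓡 3)) x) :
    (einsteinStatic k).IsPastTimelike x v ↔
      ‖mvfderiv (𝓘(ℝ, ℝ).prod (𝓡 3)) (fun p : ℝ × S3 => (p.2 : EuclideanSpace ℝ (Fin 4))) x v‖ <
        -mvfderiv (𝓘(ℝ, ℝ).prod (𝓡 3)) (Prod.fst : ℝ × S3 → ℝ) x v := by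
  have h1 : mvfderiv (𝓘(ℝ, ℝ).prod (𝓡 3)) (Prod.fst : ℝ × S3 → ℝ) x
      ((einsteinStatic k).timeField x) = 1 := mvfderiv_esu_time x _
  have h2 : mvfderiv (𝓘(ℝ, ℝ).prod (𝓡 3)) (fun p : ℝ × S3 => (p.2 : EuclideanSpace ℝ (Fin 4))) x
      ((einsteinStatic k).timeField x) = 0 := (mvfderiv_esu_space x _).trans (map_zero _)
  change warpedForm _ _ _ _ _ _ _ < 0 ∧ 0 < warpedForm _ _ _ _ _ _ _ ↔ _
  rw [warpedForm_apply, warpedForm_apply, h1, h2, inner_zero_right, real_inner_self_eq_norm_sq]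
  constructor
  · rintro ⟨h3, h4⟩
    refine lt_of_pow_lt_pow_left₀ 2 (by linarith) (by linarith)
  · intro h3
    have h4 := pow_lt_pow_left₀ h3 (norm_nonneg _) two_ne_zero
    have h5 := (norm_nonneg _).trans_lt h3
    constructor <;> linarith

theorem hasDerivWithinAt_esu {γ : ℝ → ℝ × S3} {s : Set ℝ} {u : ℝ}
    (hγ : MDifferentiableWithinAt 𝓘(ℝ, ℝ) (𝓘(ℝ, ℝ).prod (𝓡 3)) γ s u) :
    HasDerivWithinAt (fun u => (γ u).1) (mvfderiv (𝓘(ℝ, ℝ).prod (𝓡 3)) (Prod.fst : ℝ × S3 → ℝ) (γ u)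
      (mfderivWithin 𝓘(ℝ, ℝ) (𝓘(ℝ, ℝ).prod (𝓡 3)) γ s u (1 : ℝ))) s u ∧
    HasDerivWithinAt (fun u => ((γ u).2 : EuclideanSpace ℝ (Fin 4)))
      (mvfderiv (𝓘(ℝ, ℝ).prod (𝓡 3)) (fun p : ℝ × S3 => (p.2 : EuclideanSpace ℝ (Fin 4))) (γ u)
      (mfderivWithin 𝓘(ℝ, ℝ) (𝓘(ℝ, ℝ).prod (𝓡 3)) γ s u (1 : ℝ))) s u := by
  have h1 : MDifferentiableAt (𝓘(ℝ, ℝ).prod (𝓡 3)) 𝓘(ℝ, ℝ) (Prod.fst : ℝ × S3 → ℝ) (γ u) :=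
    mdifferentiableAt_fst
  have h2 : MDifferentiableAt (𝓘(ℝ, ℝ).prod (𝓡 3)) 𝓘(ℝ, EuclideanSpace ℝ (Fin 4))
      (fun p : ℝ × S3 => (p.2 : EuclideanSpace ℝ (Fin 4))) (γ u) :=
    (contMDiff_coe_S3.comp contMDiff_snd).mdifferentiable (by simp) _
  have h3 : HasFDerivWithinAt (fun u => (γ u).1) (show ℝ →L[ℝ] ℝ from
      (mvfderiv (𝓘(ℝ, ℝ).prod (𝓡 3)) (Prod.fst : ℝ × S3 → ℝ) (γ u)).comp
        (mfderivWithin 𝓘(ℝ, ℝ) (𝓘(ℝ, ℝ).prod (𝓡 3)) γ s u)) s u :=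
    (h1.hasMFDerivAt.comp_hasMFDerivWithinAt u hγ.hasMFDerivWithinAt).hasFDerivWithinAt
  have h4 : HasFDerivWithinAt (fun u => ((γ u).2 : EuclideanSpace ℝ (Fin 4)))
      (show ℝ →L[ℝ] EuclideanSpace ℝ (Fin 4) from
      (mvfderiv (𝓘(ℝ, ℝ).prod (𝓡 3)) (fun p : ℝ × S3 => (p.2 : EuclideanSpace ℝ (Fin 4))) (γ u)).comp
        (mfderivWithin 𝓘(ℝ, ℝ) (𝓘(ℝ, ℝ).prod (𝓡 3)) γ s u)) s u :=
    (h2.hasMFDerivAt.comp_hasMFDerivWithinAt u hγ.hasMFDerivWithinAt).hasFDerivWithinAt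
  exact ⟨h3.hasDerivWithinAt, h4.hasDerivWithinAt⟩

/-- A curve whose velocities satisfy `P` increases any function that increases along its `C^1`
pieces. -/
theorem lt_of_isPiecewiseC1With {P : ∀ x : ℝ × S3, TangentSpace (𝓘(ℝ, ℝ).prod (𝓡 3)) x → Prop}
    {γ : ℝ → ℝ × S3} {a b : ℝ}
    (hγ : Spacetime.IsPiecewiseC1With (𝓘(ℝ, ℝ).prod (𝓡 3)) P γ a b) {f : ℝ × S3 → ℝ}
    (hf : Continuous f)
    (h : ∀ c d, c < d → ContMDiffOn 𝓘(ℝ, ℝ) (𝓘(ℝ, ℝ).prod (𝓡 3)) 1 γ (Icc c d) →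
      ∀ u ∈ Ico c d, P (γ u) (mfderivWithin 𝓘(ℝ, ℝ) (𝓘(ℝ, ℝ).prod (𝓡 3)) γ (Icc c d) u (1 : ℝ)) →
      ∀ᶠ w in 𝓝[>] u, f (γ u) < f (γ w)) :
    a < b ∧ f (γ a) < f (γ b) := by
  obtain ⟨n, s, hn, rfl, rfl, hs⟩ := hγ
  have key : ∀ i < n, s 0 < s (i + 1) ∧ f (γ (s 0)) < f (γ (s (i + 1))) := by
    intro i
    induction i with
    | zero =>
      intro hi
      obtain ⟨h1, h2, h3⟩ := hs 0 hi
      exact ⟨h1, lt_of_forall_eventually_nhdsGT_lt h1 (hf.comp_continuousOn h2.continuousOn)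
        fun u hu => h _ _ h1 h2 u hu (h3 u (Ico_subset_Icc_self hu))⟩
    | succ i ih =>
      intro hi
      obtain ⟨h1, h2, h3⟩ := hs (i + 1) hi
      obtain ⟨h4, h5⟩ := ih (i.lt_succ_self.trans hi)
      exact ⟨h4.trans h1, h5.trans (lt_of_forall_eventually_nhdsGT_lt h1
        (hf.comp_continuousOn h2.continuousOn)
        fun u hu => h _ _ h1 h2 u hu (h3 u (Ico_subset_Icc_self hu)))⟩
  obtain ⟨m, rfl⟩ := Nat.exists_eq_succ_of_ne_zero hn.ne'
  exact key m m.lt_succ_self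

theorem hasDerivWithinAt_Ioi_of_Icc {F : Type*} [NormedAddCommGroup F] [NormedSpace ℝ F]
    {f : ℝ → F} {f' : F} {c d u : ℝ} (hu : u ∈ Ico c d) (h : HasDerivWithinAt f f' (Icc c d) u) :
    HasDerivWithinAt f f' (Ioi u) u :=
  (h.mono (show Ioo u d ⊆ Icc c d from
    fun _ hx => ⟨hu.1.trans hx.1.le, hx.2.le⟩)).mono_of_mem_nhdsWithin (Ioo_mem_nhdsGT hu.2)

/-- `T' - χ` increases along future-directed timelike curves. -/
theorem time_sub_chi_lt {γ : ℝ → ℝ × S3} {a b : ℝ}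
    (hγ : (einsteinStatic k).IsFutureTimelikeCurve γ a b) :
    a < b ∧ (γ a).1 - EinsteinStatic.chi (γ a).2 < (γ b).1 - EinsteinStatic.chi (γ b).2 := by
  refine lt_of_isPiecewiseC1With hγ (f := fun p => p.1 - EinsteinStatic.chi p.2)
    (continuous_fst.sub (EinsteinStatic.continuous_chi.comp continuous_snd)) ?_
  intro c d _ h2 u hu hP
  rw [einsteinStatic_isFutureTimelike_iff] at hP
  obtain ⟨hT, hq⟩ := hasDerivWithinAt_esu
    ((h2.mdifferentiableOn one_ne_zero) u (Ico_subset_Icc_self hu))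
  filter_upwards [EinsteinStatic.eventually_angle_lt (fun u => norm_S3 (γ u).2)
    (hasDerivWithinAt_Ioi_of_Icc hu hT) (hasDerivWithinAt_Ioi_of_Icc hu hq) hP] with w hw
  have := EinsteinStatic.chi_le_add_angle (γ u).2 (γ w).2
  linarith

/-- `T'` decreases along past-directed timelike curves. -/
theorem time_lt_of_past {γ : ℝ → ℝ × S3} {a b : ℝ}
    (hγ : (einsteinStatic k).IsPastTimelikeCurve γ a b) : a < b ∧ (γ b).1 < (γ a).1 := by
  have := lt_of_isPiecewiseC1With hγ (f := fun p => -p.1) continuous_fst.neg ?_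
  · exact ⟨this.1, neg_lt_neg_iff.1 this.2⟩
  intro c d _ h2 u hu hP
  rw [einsteinStatic_isPastTimelike_iff] at hP
  obtain ⟨hT, hq⟩ := hasDerivWithinAt_esu
    ((h2.mdifferentiableOn one_ne_zero) u (Ico_subset_Icc_self hu))
  filter_upwards [EinsteinStatic.eventually_angle_lt (T := fun u => -(γ u).1)
    (fun u => norm_S3 (γ u).2) (hasDerivWithinAt_Ioi_of_Icc hu hT).neg
    (hasDerivWithinAt_Ioi_of_Icc hu hq) hP] with w hw
  have := InnerProductGeometry.angle_nonneg ((γ u).2 : EuclideanSpace ℝ (Fin 4)) (γ w).2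
  linarith

theorem isPiecewiseC1With_of_contMDiff
    {P : ∀ x : ℝ × S3, TangentSpace (𝓘(ℝ, ℝ).prod (𝓡 3)) x → Prop} {γ : ℝ → ℝ × S3} {a b : ℝ}
    (hab : a < b) (hγ : ContMDiff 𝓘(ℝ, ℝ) (𝓘(ℝ, ℝ).prod (𝓡 3)) 1 γ)
    (h : ∀ u ∈ Icc a b,
      P (γ u) (mfderivWithin 𝓘(ℝ, ℝ) (𝓘(ℝ, ℝ).prod (𝓡 3)) γ (Icc a b) u (1 : ℝ))) :
    Spacetime.IsPiecewiseC1With (𝓘(ℝ, ℝ).prod (𝓡 3)) P γ a b := by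
  refine ⟨1, fun i => if i = 0 then a else b, one_pos, rfl, rfl, fun i hi => ?_⟩
  obtain rfl := Nat.lt_one_iff.1 hi
  exact ⟨hab, hγ.contMDiffOn, h⟩

theorem mvfderiv_velocity_eq {γ : ℝ → ℝ × S3} {a b : ℝ} (hab : a < b)
    (hγ : ContMDiff 𝓘(ℝ, ℝ) (𝓘(ℝ, ℝ).prod (𝓡 3)) 1 γ) {T' : ℝ} {q' : EuclideanSpace ℝ (Fin 4)}
    {u : ℝ} (hu : u ∈ Icc a b) (hT : HasDerivAt (fun u => (γ u).1) T' u)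
    (hq : HasDerivAt (fun u => ((γ u).2 : EuclideanSpace ℝ (Fin 4))) q' u) :
    mvfderiv (𝓘(ℝ, ℝ).prod (𝓡 3)) (Prod.fst : ℝ × S3 → ℝ) (γ u)
      (mfderivWithin 𝓘(ℝ, ℝ) (𝓘(ℝ, ℝ).prod (𝓡 3)) γ (Icc a b) u (1 : ℝ)) = T' ∧
    mvfderiv (𝓘(ℝ, ℝ).prod (𝓡 3)) (fun p : ℝ × S3 => (p.2 : EuclideanSpace ℝ (Fin 4))) (γ u)
      (mfderivWithin 𝓘(ℝ, ℝ) (𝓘(ℝ, ℝ).prod (𝓡 3)) γ (Icc a b) u (1 : ℝ)) = q' := by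
  obtain ⟨h1, h2⟩ := hasDerivWithinAt_esu (s := Icc a b)
    ((hγ.mdifferentiable one_ne_zero) u).mdifferentiableWithinAt
  have hU := uniqueDiffOn_Icc hab u hu
  exact ⟨hU.eq_deriv _ h1 hT.hasDerivWithinAt, hU.eq_deriv _ h2 hq.hasDerivWithinAt⟩

theorem isFutureTimelikeCurve_of_hasDerivAt {γ : ℝ → ℝ × S3} {a b : ℝ} (hab : a < b)
    (hγ : ContMDiff 𝓘(ℝ, ℝ) (𝓘(ℝ, ℝ).prod (𝓡 3)) 1 γ) {T' : ℝ → ℝ}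
    {q' : ℝ → EuclideanSpace ℝ (Fin 4)} (hT : ∀ u, HasDerivAt (fun u => (γ u).1) (T' u) u)
    (hq : ∀ u, HasDerivAt (fun u => ((γ u).2 : EuclideanSpace ℝ (Fin 4))) (q' u) u)
    (h : ∀ u, ‖q' u‖ < T' u) : (einsteinStatic k).IsFutureTimelikeCurve γ a b :=
  isPiecewiseC1With_of_contMDiff hab hγ fun u hu => by
    obtain ⟨h1, h2⟩ := mvfderiv_velocity_eq hab hγ hu (hT u) (hq u)
    rw [einsteinStatic_isFutureTimelike_iff, h1, h2]
    exact h u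

theorem isPastTimelikeCurve_of_hasDerivAt {γ : ℝ → ℝ × S3} {a b : ℝ} (hab : a < b)
    (hγ : ContMDiff 𝓘(ℝ, ℝ) (𝓘(ℝ, ℝ).prod (𝓡 3)) 1 γ) {T' : ℝ → ℝ}
    {q' : ℝ → EuclideanSpace ℝ (Fin 4)} (hT : ∀ u, HasDerivAt (fun u => (γ u).1) (T' u) u)
    (hq : ∀ u, HasDerivAt (fun u => ((γ u).2 : EuclideanSpace ℝ (Fin 4))) (q' u) u)
    (h : ∀ u, ‖q' u‖ < -T' u) : (einsteinStatic k).IsPastTimelikeCurve γ a b :=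
  isPiecewiseC1With_of_contMDiff hab hγ fun u hu => by
    obtain ⟨h1, h2⟩ := mvfderiv_velocity_eq hab hγ hu (hT u) (hq u)
    rw [einsteinStatic_isPastTimelike_iff, h1, h2]
    exact h u

theorem isFutureTimelikeCurve_vertical (q : S3) {a b : ℝ} (hab : a < b) :
    (einsteinStatic k).IsFutureTimelikeCurve (fun u => (u, q)) a b :=
  isFutureTimelikeCurve_of_hasDerivAt hab (contMDiff_id.prodMk contMDiff_const)
    (T' := fun _ => 1) (q' := fun _ => 0)
    (fun u => hasDerivAt_id u) (fun u => hasDerivAt_const u (q : EuclideanSpace ℝ (Fin 4))) (by simp)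

theorem isPastTimelikeCurve_vertical (q : S3) {a b : ℝ} (hab : a < b) :
    (einsteinStatic k).IsPastTimelikeCurve (fun u => (-u, q)) a b :=
  isPastTimelikeCurve_of_hasDerivAt hab (contMDiff_id.neg.prodMk contMDiff_const)
    (T' := fun _ => -1) (q' := fun _ => 0)
    (fun u => (hasDerivAt_id u).neg) (fun u => hasDerivAt_const u (q : EuclideanSpace ℝ (Fin 4))) (by simp)

theorem exists_unit_tailVec (q : S3) : ∃ y : EuclideanSpace ℝ (Fin 3), ‖y‖ = 1 ∧
    (q : EuclideanSpace ℝ (Fin 4)) =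
      consCLM (Real.cos (EinsteinStatic.chi q), Real.sin (EinsteinStatic.chi q) • y) := by
  have h1 : Real.sin (EinsteinStatic.chi q) = ‖tailVec q‖ := by
    have h2 := norm_sq_eq_tailVec (q : EuclideanSpace ℝ (Fin 4))
    rw [norm_S3] at h2
    rw [EinsteinStatic.chi, Real.sin_arccos, ← Real.sqrt_sq (norm_nonneg (tailVec _))]
    congr 1
    linarith
  rcases eq_or_ne (tailVec (q : EuclideanSpace ℝ (Fin 4))) 0 with h | h
  · refine ⟨EuclideanSpace.single 0 1, by simp, ?_⟩
    rw [h1, h, norm_zero, zero_smul, EinsteinStatic.cos_chi, ← h, consCLM_tailVec]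
  · refine ⟨‖tailVec (q : EuclideanSpace ℝ (Fin 4))‖⁻¹ • tailVec q, norm_smul_inv_norm h, ?_⟩
    rw [h1, smul_inv_smul₀ (norm_ne_zero_iff.2 h), EinsteinStatic.cos_chi, consCLM_tailVec]

/-- Every point `(T', q)` with `χ(q) < T' + π/2` is reached from `𝒪` by a timelike curve along a
great circle. -/
theorem exists_future_curve_from_pointO {T : ℝ} {q : S3}
    (h : EinsteinStatic.chi q < T + Real.pi / 2) : ∃ γ : ℝ → ℝ × S3,
    (einsteinStatic k).IsFutureTimelikeCurve γ 0 1 ∧ γ 0 = EinsteinStatic.pointO ∧ γ 1 = (T, q) ∧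
      ∀ u ∈ Icc (0 : ℝ) 1, (γ u).1 ≤ T := by
  have := finrank_four
  obtain ⟨y, hy, hq⟩ := exists_unit_tailVec q
  set χ := EinsteinStatic.chi q with hχ
  have hχ0 : 0 ≤ χ := EinsteinStatic.chi_nonneg q
  set c : ℝ → EuclideanSpace ℝ (Fin 4) := fun u =>
    consCLM (Real.cos (u * χ), Real.sin (u * χ) • y) with hc
  have hnorm : ∀ A B : ℝ, ‖consCLM (A, B • y)‖ ^ 2 = A ^ 2 + B ^ 2 := fun A B => by
    rw [← real_inner_self_eq_norm_sq, inner_consCLM, real_inner_self_eq_norm_sq, norm_smul, hy,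
      Real.norm_eq_abs, mul_one, sq_abs]
    ring
  have hc1 : ∀ u, c u ∈ Metric.sphere (0 : EuclideanSpace ℝ (Fin 4)) 1 := fun u => by
    rw [mem_sphere_zero_iff_norm]
    refine (sq_eq_sq₀ (norm_nonneg _) zero_le_one).1 ?_
    rw [hc, hnorm, Real.cos_sq_add_sin_sq, one_pow]
  have hd : ∀ u, HasDerivAt c (consCLM (-Real.sin (u * χ) * (1 * χ),
      (Real.cos (u * χ) * (1 * χ)) • y)) u := fun u => by
    have h1 : HasDerivAt (fun u => u * χ) (1 * χ) u := (hasDerivAt_id u).mul_const χ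
    exact consCLM.hasFDerivAt.comp_hasDerivAt u (h1.cos.prodMk (h1.sin.smul_const y))
  have hcs : ContDiff ℝ 1 c := by
    have h1 : ContDiff ℝ 1 (fun u : ℝ => u * χ) := contDiff_id.mul contDiff_const
    exact consCLM.contDiff.comp (h1.cos.prodMk (h1.sin.smul contDiff_const))
  have hTs : ContDiff ℝ 1 (fun u : ℝ => -(Real.pi / 2) + u * (T + Real.pi / 2)) :=
    contDiff_const.add (contDiff_id.mul contDiff_const)
  refine ⟨fun u => (-(Real.pi / 2) + u * (T + Real.pi / 2), ⟨c u, hc1 u⟩), ?_, ?_, ?_, ?_⟩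
  · refine isFutureTimelikeCurve_of_hasDerivAt zero_lt_one
      (hTs.contMDiff.prodMk (hcs.contMDiff.codRestrict_sphere hc1))
      (fun u => ((hasDerivAt_id u).mul_const _).const_add _) hd fun u => ?_
    refine lt_of_pow_lt_pow_left₀ 2 (by linarith) ?_
    rw [hnorm]
    have := pow_lt_pow_left₀ h hχ0 two_ne_zero
    linear_combination this + χ ^ 2 * Real.sin_sq_add_cos_sq (u * χ)
  · refine Prod.ext (by simp [EinsteinStatic.pointO]) (Subtype.ext ?_)
    simp [hc, EinsteinStatic.pointO, EinsteinStatic.northPole_coe]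
  · refine Prod.ext (by simp) (Subtype.ext ?_)
    simp only [hc, one_mul, ← hq]
  · intro u hu
    have := mul_nonneg (sub_nonneg.2 hu.2) (hχ0.trans h.le)
    simp only
    linarith

end Curves

/-! ### The region between the null cone and `Σ⁺` -/

namespace EinsteinStatic

theorem eq_northPole_of_chi {q : S3} (h : chi q = 0) : q = northPole := by
  have h1 : inner ℝ ((northPole : S3) : EuclideanSpace ℝ (Fin 4)) q = 1 := by
    rw [inner_northPole, ← cos_chi, h, Real.cos_zero]
  exact Subtype.ext ((inner_eq_one_iff_of_norm_eq_one (norm_S3 _) (norm_S3 _)).1 h1).symm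

theorem eq_southPole_of_chi {q : S3} (h : chi q = Real.pi) : q = southPole := by
  have h1 : inner ℝ ((northPole : S3) : EuclideanSpace ℝ (Fin 4)) ((-q : S3) : _) = 1 := by
    rw [inner_northPole]
    have := cos_chi q
    rw [h, Real.cos_pi] at this
    simp [← this]
  have h2 := Subtype.ext ((inner_eq_one_iff_of_norm_eq_one (norm_S3 _) (norm_S3 _)).1 h1)
  rw [southPole, h2, neg_neg]

/-- The region `χ - π/2 < T' < π/2`, the image of the half Minkowski space. -/
def esuRegion : Set (ℝ × S3) :=
  {p | chi p.2 - Real.pi / 2 < p.1 ∧ p.1 < Real.pi / 2}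

theorem isOpen_esuRegion : IsOpen esuRegion :=
  (isOpen_lt ((continuous_chi.comp continuous_snd).sub continuous_const) continuous_fst).inter
    (isOpen_lt continuous_fst continuous_const)

theorem sin_add_eq (p : ℝ × S3) :
    Real.sin p.1 + p.2.1 0 = Real.sin p.1 - Real.sin (chi p.2 - Real.pi / 2) := by
  rw [Real.sin_sub_pi_div_two, cos_chi]
  ring

theorem chi_sub_mem (q : S3) : chi q - Real.pi / 2 ∈ Icc (-(Real.pi / 2)) (Real.pi / 2) :=
  ⟨by linarith [chi_nonneg q], by linarith [chi_le_pi q]⟩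

theorem mem_esuRegion_iff {p : ℝ × S3} :
    p ∈ esuRegion ↔
      p.1 ∈ Ioo (-(Real.pi / 2)) (Real.pi / 2) ∧ 0 < Real.sin p.1 + p.2.1 0 := by
  have h := chi_sub_mem p.2
  rw [sin_add_eq, sub_pos]
  constructor
  · rintro ⟨h1, h2⟩
    have h3 : -(Real.pi / 2) < p.1 := h.1.trans_lt h1
    exact ⟨⟨h3, h2⟩, Real.strictMonoOn_sin h ⟨h3.le, h2.le⟩ h1⟩
  · rintro ⟨h1, h2⟩
    exact ⟨(Real.strictMonoOn_sin.lt_iff_lt h (Ioo_subset_Icc_self h1)).1 h2, h1.2⟩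

instance connectedSpace_S3 : ConnectedSpace S3 := Subtype.connectedSpace
  (isConnected_sphere (by rw [← Module.finrank_eq_rank]; simp) 0 zero_le_one)

instance nontrivial_S3 : Nontrivial S3 := ⟨northPole, southPole, fun h => by
  have := congrArg chi h
  rw [chi_northPole, chi_southPole] at this
  exact Real.pi_ne_zero this.symm⟩

theorem closure_esuRegion :
    closure esuRegion = {p | chi p.2 - Real.pi / 2 ≤ p.1 ∧ p.1 ≤ Real.pi / 2} := by
  refine subset_antisymm (closure_minimal (fun p hp => ⟨hp.1.le, hp.2.le⟩) ?_) ?_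
  · exact (isClosed_le ((continuous_chi.comp continuous_snd).sub continuous_const)
      continuous_fst).inter (isClosed_le continuous_fst continuous_const)
  have key : ∀ p : ℝ × S3, chi p.2 < Real.pi → chi p.2 - Real.pi / 2 ≤ p.1 →
      p.1 ≤ Real.pi / 2 → p ∈ closure esuRegion := by
    rintro ⟨T, q⟩ h1 h2 h3
    simp only at h1 h2 h3
    have h4 : T ∈ closure (Ioo (chi q - Real.pi / 2) (Real.pi / 2)) := by
      rw [closure_Ioo (by linarith)]
      exact ⟨h2, h3⟩
    exact map_mem_closure (f := fun T => (T, q)) (by fun_prop) h4 fun T' hT' => hT'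
  rintro ⟨T, q⟩ ⟨h1, h2⟩
  simp only at h1 h2
  rcases (chi_le_pi q).lt_or_eq with h | h
  · exact key _ h h1 h2
  · obtain rfl : T = Real.pi / 2 := le_antisymm h2 (by rw [h] at h1; linarith)
    have h3 : q ∈ closure ({q}ᶜ : Set S3) := by
      rw [closure_compl_singleton]
      trivial
    rw [← closure_closure]
    refine map_mem_closure (f := fun q => (Real.pi / 2, q)) (by fun_prop) h3 fun q' hq' => ?_
    refine key _ (lt_of_le_of_ne (chi_le_pi _) fun h4 => hq' ?_)
      (by linarith [chi_le_pi q']) le_rfl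
    rw [mem_singleton_iff, eq_southPole_of_chi h]
    exact eq_southPole_of_chi h4

theorem mem_frontier_esuRegion_iff {p : ℝ × S3} :
    p ∈ frontier esuRegion ↔ p.1 = Real.pi / 2 ∨ p.1 = chi p.2 - Real.pi / 2 := by
  have h := chi_sub_mem p.2
  rw [isOpen_esuRegion.frontier_eq, closure_esuRegion]
  constructor
  · rintro ⟨⟨h1, h2⟩, h3⟩
    by_contra! h4
    exact h3 ⟨lt_of_le_of_ne h1 h4.2.symm, lt_of_le_of_ne h2 h4.1⟩
  · rintro (h1 | h1)
    · exact ⟨⟨h1 ▸ h.2, h1.le⟩, fun h2 => h2.2.ne h1⟩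
    · exact ⟨⟨h1.ge, h1 ▸ h.2⟩, fun h2 => h2.1.ne' h1⟩

theorem hasFutureTerminatingCurve_iff {k : ℕ∞} {p : ℝ × S3} (hp : p ∈ frontier esuRegion) :
    (einsteinStatic k).HasFutureTerminatingCurve esuRegion p ↔
      p.1 = Real.pi / 2 ∧ chi p.2 < Real.pi := by
  constructor
  · rintro ⟨γ, a, b, hγ, rfl, hA⟩
    obtain ⟨hab, h1⟩ := time_sub_chi_lt hγ
    have h2 := (hA ⟨le_rfl, hab⟩).1
    have h3 : (γ b).1 = Real.pi / 2 := (mem_frontier_esuRegion_iff.1 hp).resolve_right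
      fun h3 => by linarith
    exact ⟨h3, by linarith⟩
  · rintro ⟨h1, h2⟩
    refine ⟨fun u => (u, p.2), chi p.2 - Real.pi / 2 + (Real.pi - chi p.2) / 2, Real.pi / 2,
      isFutureTimelikeCurve_vertical p.2 (by linarith), Prod.ext h1.symm rfl, fun u hu => ?_⟩
    exact ⟨by linarith [hu.1], hu.2⟩

theorem hasPastTerminatingCurve_iff {k : ℕ∞} {p : ℝ × S3} (hp : p ∈ frontier esuRegion) :
    (einsteinStatic k).HasPastTerminatingCurve esuRegion p ↔
      p.1 = chi p.2 - Real.pi / 2 ∧ chi p.2 < Real.pi := by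
  constructor
  · rintro ⟨γ, a, b, hγ, rfl, hA⟩
    obtain ⟨hab, h1⟩ := time_lt_of_past hγ
    have h2 := (hA ⟨le_rfl, hab⟩).2
    have h3 : (γ b).1 = chi (γ b).2 - Real.pi / 2 :=
      (mem_frontier_esuRegion_iff.1 hp).resolve_left fun h3 => by linarith
    exact ⟨h3, by linarith⟩
  · rintro ⟨h1, h2⟩
    refine ⟨fun u => (-u, p.2), -(chi p.2 - Real.pi / 2 + (Real.pi - chi p.2) / 2),
      -(chi p.2 - Real.pi / 2), isPastTimelikeCurve_vertical p.2 (by linarith),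
      Prod.ext ((neg_neg _).trans h1.symm) rfl, fun u hu => ?_⟩
    exact ⟨lt_neg_of_lt_neg hu.2, by linarith [hu.1]⟩

theorem pointO_mem_iff {p : ℝ × S3} : p = pointO ↔ p.1 = chi p.2 - Real.pi / 2 ∧ chi p.2 = 0 := by
  constructor
  · rintro rfl
    simp [pointO, chi_northPole]
  · rintro ⟨h1, h2⟩
    exact Prod.ext (by rw [h1, h2, pointO, zero_sub]) (eq_northPole_of_chi h2)

theorem pointP_mem_iff {p : ℝ × S3} : p = pointP ↔ p.1 = Real.pi / 2 ∧ chi p.2 = Real.pi := by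
  constructor
  · rintro rfl
    simp [pointP, chi_southPole]
  · rintro ⟨h1, h2⟩
    exact Prod.ext h1 (eq_southPole_of_chi h2)

theorem pointO_ne_pointP : pointO ≠ pointP := fun h => by
  have := (pointP_mem_iff.1 h).2
  rw [pointO, chi_northPole] at this
  exact Real.pi_ne_zero this.symm

theorem mem_coneB_iff {p : ℝ × S3} :
    p ∈ coneB ↔ p.1 = chi p.2 - Real.pi / 2 ∧ 0 < chi p.2 ∧ chi p.2 < Real.pi := by
  constructor
  · rintro ⟨-, h2, h3⟩
    exact ⟨h3, h2⟩
  · rintro ⟨h1, h2, h3⟩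
    exact ⟨⟨by linarith, by linarith⟩, ⟨h2, h3⟩, h1⟩

theorem esuRegion_eq_timelikeFuture {k : ℕ∞} :
    esuRegion = (einsteinStatic k).timelikeFuture pointO belowSigma := by
  ext ⟨T, q⟩
  constructor
  · rintro ⟨h1, h2⟩
    simp only at h1 h2
    obtain ⟨γ, hγ, h0, h1, hT⟩ := exists_future_curve_from_pointO (k := k) (sub_lt_iff_lt_add.1 h1)
    exact ⟨γ, 0, 1, hγ, fun u hu => (hT u hu).trans_lt h2, h0, h1⟩
  · rintro ⟨γ, a, b, hγ, hU, h0, h1⟩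
    obtain ⟨hab, h2⟩ := time_sub_chi_lt hγ
    rw [h0, h1, pointO, chi_northPole] at h2
    have h3 : (γ b).1 < Real.pi / 2 := hU ⟨hab.le, le_rfl⟩
    rw [h1] at h3
    exact ⟨by simp only at h2 ⊢; linarith, h3⟩

/-! ### The conformal factor and the boundaries -/

/-- The conformal factor as a function on the Einstein static universe. -/
def esuFactor (b : ℝ → ℝ) (h : ℝ) (p : ℝ × S3) : ℝ :=
  homogeneousExtension b h (Real.cos p.1) (Real.sin p.1 + p.2.1 0)

section Factor

variable {b : ℝ → ℝ} {h : ℝ}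

theorem cos_nonneg_sin_add_nonneg {p : ℝ × S3} (hp : p ∈ closure esuRegion) :
    0 ≤ Real.cos p.1 ∧ 0 ≤ Real.sin p.1 + p.2.1 0 := by
  rw [closure_esuRegion] at hp
  have h1 := chi_sub_mem p.2
  have h2 : p.1 ∈ Icc (-(Real.pi / 2)) (Real.pi / 2) := ⟨h1.1.trans hp.1, hp.2⟩
  refine ⟨Real.cos_nonneg_of_mem_Icc h2, ?_⟩
  rw [sin_add_eq]
  exact sub_nonneg.2 (Real.strictMonoOn_sin.monotoneOn h1 h2 hp.1)

theorem continuousOn_esuFactor (hb : Continuous b)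
    (hlim : Tendsto (fun y => b y / -y) atBot (𝓝 h)) :
    ContinuousOn (esuFactor b h) (closure esuRegion) := by
  have h1 : Continuous (fun p : ℝ × S3 => (Real.cos p.1, Real.sin p.1 + p.2.1 0)) := by fun_prop
  exact (continuousOn_homogeneousExtension hb hlim).comp h1.continuousOn
    fun p hp => cos_nonneg_sin_add_nonneg hp

theorem esuFactor_nonneg (hb : ∀ y, 0 < b y) (hh : 0 < h) {p : ℝ × S3}
    (hp : p ∈ closure esuRegion) : 0 ≤ esuFactor b h p := by
  obtain ⟨h1, h2⟩ := cos_nonneg_sin_add_nonneg hp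
  rw [esuFactor, homogeneousExtension]
  split_ifs with hv
  · exact mul_nonneg h2 (hb _).le
  · exact mul_nonneg hh.le h1

theorem conformalBoundary_esuRegion (hb : ∀ y, 0 < b y) (hh : 0 < h) :
    conformalBoundary esuRegion (esuFactor b h) = {pointO} ∪ {pointP} := by
  ext p
  have hχ := chi_sub_mem p.2
  simp only [conformalBoundary, mem_ofPred_eq, mem_union, mem_singleton_iff,
    pointO_mem_iff, pointP_mem_iff, mem_frontier_esuRegion_iff]
  constructor
  · rintro ⟨h1, h2⟩
    rw [esuFactor, homogeneousExtension] at h2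
    split_ifs at h2 with hv
    · exact absurd h2 (mul_pos hv (hb _)).ne'
    · have hc : Real.cos p.1 = 0 := (mul_eq_zero.1 h2).resolve_left hh.ne'
      rcases h1 with h1 | h1
      · right
        refine ⟨h1, ?_⟩
        rw [h1, Real.sin_pi_div_two, ← cos_chi] at hv
        by_contra hne
        have h3 := Real.strictAntiOn_cos ⟨chi_nonneg _, chi_le_pi _⟩
          ⟨Real.pi_pos.le, le_rfl⟩ (lt_of_le_of_ne (chi_le_pi p.2) hne)
        rw [Real.cos_pi] at h3
        linarith
      · rcases (chi_nonneg p.2).lt_or_eq with h3 | h3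
        · rcases (chi_le_pi p.2).lt_or_eq with h4 | h4
          · exact absurd hc (Real.cos_pos_of_mem_Ioo ⟨by linarith, by linarith⟩).ne'
          · exact Or.inr ⟨by rw [h1, h4]; ring, h4⟩
        · exact Or.inl ⟨h1, h3.symm⟩
  · have h0 : Real.sin p.1 + p.2.1 0 = 0 → Real.cos p.1 = 0 → esuFactor b h p = 0 := by
      intro h1 h2
      simp [esuFactor, homogeneousExtension, h1, h2]
    rintro (⟨h1, h2⟩ | ⟨h1, h2⟩)
    · refine ⟨Or.inr h1, h0 (by rw [sin_add_eq, ← h1, sub_self]) ?_⟩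
      rw [h1, h2, zero_sub, Real.cos_neg, Real.cos_pi_div_two]
    · refine ⟨Or.inl h1, h0 ?_ (by rw [h1, Real.cos_pi_div_two])⟩
      rw [h1, ← cos_chi, h2, Real.cos_pi, Real.sin_pi_div_two, add_neg_cancel]

theorem pastConformalBoundary_esuRegion {k : ℕ∞} (hb : ∀ y, 0 < b y) (hh : 0 < h) :
    pastConformalBoundary (einsteinStatic k) esuRegion (esuFactor b h) = {pointO} := by
  ext p
  have hπ := Real.pi_pos
  constructor
  · rintro ⟨h1, h2⟩
    rw [hasPastTerminatingCurve_iff h1.1] at h2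
    rw [conformalBoundary_esuRegion hb hh] at h1
    refine h1.resolve_right fun h3 => ?_
    exact h2.2.ne (pointP_mem_iff.1 h3).2
  · intro h1
    have h2 : p ∈ conformalBoundary esuRegion (esuFactor b h) := by
      rw [conformalBoundary_esuRegion hb hh]
      exact Or.inl h1
    obtain ⟨h3, h4⟩ := pointO_mem_iff.1 h1
    exact ⟨h2, (hasPastTerminatingCurve_iff h2.1).2 ⟨h3, h4.trans_lt hπ⟩⟩

theorem futureConformalBoundary_esuRegion {k : ℕ∞} (hb : ∀ y, 0 < b y) (hh : 0 < h) :
    futureConformalBoundary (einsteinStatic k) esuRegion (esuFactor b h) = ∅ := by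
  refine eq_empty_of_forall_notMem fun p ⟨h1, h2⟩ => ?_
  rw [hasFutureTerminatingCurve_iff h1.1] at h2
  rw [conformalBoundary_esuRegion hb hh] at h1
  rcases h1 with h1 | h1
  · obtain ⟨h3, h4⟩ := pointO_mem_iff.1 h1
    linarith [Real.pi_pos]
  · exact h2.2.ne (pointP_mem_iff.1 h1).2

theorem pastBoundary_esuRegion {k : ℕ∞} (hb : ∀ y, 0 < b y) (hh : 0 < h) :
    pastBoundary (einsteinStatic k) esuRegion (esuFactor b h) = coneB := by
  ext p
  rw [pastBoundary, conformalBoundary_esuRegion hb hh, mem_coneB_iff]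
  constructor
  · rintro ⟨⟨h1, h2⟩, h3⟩
    rw [hasPastTerminatingCurve_iff h1] at h3
    exact ⟨h3.1, lt_of_le_of_ne (chi_nonneg _) fun h4 =>
      h2 (Or.inl (pointO_mem_iff.2 ⟨h3.1, h4.symm⟩)), h3.2⟩
  · rintro ⟨h1, h2, h3⟩
    have h4 := mem_frontier_esuRegion_iff.2 (Or.inr h1)
    refine ⟨⟨h4, ?_⟩, (hasPastTerminatingCurve_iff h4).2 ⟨h1, h3⟩⟩
    rintro (h5 | h5)
    · exact h2.ne' (pointO_mem_iff.1 h5).2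
    · exact h3.ne (pointP_mem_iff.1 h5).2

theorem futureBoundary_esuRegion {k : ℕ∞} (hb : ∀ y, 0 < b y) (hh : 0 < h) :
    futureBoundary (einsteinStatic k) esuRegion (esuFactor b h) = sigmaPlus \ {pointP} := by
  ext p
  rw [futureBoundary, conformalBoundary_esuRegion hb hh]
  constructor
  · rintro ⟨⟨h1, h2⟩, h3⟩
    rw [hasFutureTerminatingCurve_iff h1] at h3
    exact ⟨h3.1, fun h4 => h2 (Or.inr h4)⟩
  · rintro ⟨h1, h2⟩
    replace h1 : p.1 = Real.pi / 2 := h1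
    have h4 := mem_frontier_esuRegion_iff.2 (Or.inl h1)
    refine ⟨⟨h4, ?_⟩, (hasFutureTerminatingCurve_iff h4).2 ⟨h1, lt_of_le_of_ne (chi_le_pi _)
      fun h5 => h2 (pointP_mem_iff.2 ⟨h1, h5⟩)⟩⟩
    rintro (h5 | h5)
    · obtain ⟨h6, h7⟩ := pointO_mem_iff.1 h5
      linarith [Real.pi_pos]
    · exact h2 h5

end Factor

end EinsteinStatic

/-! ### The embedding of the FLRW spacetime -/

theorem opens_mvfderiv_comp_val {E F : Type*} [NormedAddCommGroup E] [NormedSpace ℝ E]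
    [NormedAddCommGroup F] [NormedSpace ℝ F] (U : TopologicalSpace.Opens E) {f : E → F}
    {f' : E →L[ℝ] F} (x : U) (hf : HasFDerivAt f f' x) (v : TangentSpace 𝓘(ℝ, E) x) :
    mvfderiv 𝓘(ℝ, E) (fun y : U => f y) x v = f' v := by
  have h : mvfderiv 𝓘(ℝ, E) (fun y : U => f y) x =
      f'.comp (mvfderiv 𝓘(ℝ, E) (Subtype.val : U → E) x) :=
    (hf.hasMFDerivAt.comp x
      ((contMDiff_subtype_val (n := 1)).mdifferentiable (by simp) x).hasMFDerivAt).mfderiv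
  rw [h, ContinuousLinearMap.comp_apply, opens_mvfderiv_val]

/-- The conformal coordinates `(t, x) ↦ (η(t), x)`. -/
def conformalCoord (a : ℝ → ℝ) (t₀ : ℝ) (p : ℝ × EuclideanSpace ℝ (Fin 3)) :
    ℝ × EuclideanSpace ℝ (Fin 3) := (conformalTime a t₀ p.1, p.2)

/-- The embedding of the FLRW spacetime in the Einstein static universe. -/
def flrwToESU (a : ℝ → ℝ) (t₀ : ℝ) (p : FLRWRegion t₀) : ℝ × S3 :=
  (esuTime (conformalCoord a t₀ p),
    ⟨esuVec (conformalCoord a t₀ p), mem_sphere_zero_iff_norm.2 norm_esuVec⟩)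

section Embedding

open EinsteinStatic

variable {a : ℝ → ℝ} {tmax t₀ h : ℝ}

theorem conformalCoord_fst_neg (hc : ContinuousOn a (Iio tmax)) (hpos : ∀ t < tmax, 0 < a t)
    (ht₀ : t₀ < tmax) (p : FLRWRegion t₀) : (conformalCoord a t₀ p).1 < 0 :=
  conformalTime_neg hc hpos ht₀ p.2

theorem contDiffAt_conformalCoord (hc : ContDiffOn ℝ ∞ a (Iio tmax))
    (hpos : ∀ t < tmax, 0 < a t) (ht₀ : t₀ < tmax) (p : FLRWRegion t₀) :
    ContDiffAt ℝ ∞ (conformalCoord a t₀) p := by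
  have h1 : ContDiffAt ℝ ∞ (conformalTime a t₀) (p : ℝ × EuclideanSpace ℝ (Fin 3)).1 :=
    (contDiffOn_conformalTime hc hpos ht₀).contDiffAt (Iio_mem_nhds (p.2.trans ht₀))
  exact (h1.comp _ contDiffAt_fst).prodMk contDiffAt_snd

theorem hasFDerivAt_conformalCoord (hc : ContinuousOn a (Iio tmax))
    (hpos : ∀ t < tmax, 0 < a t) (ht₀ : t₀ < tmax) (p : FLRWRegion t₀) :
    HasFDerivAt (conformalCoord a t₀)
      (((1 / a (FLRWRegion.time p)) • ContinuousLinearMap.fst ℝ ℝ (EuclideanSpace ℝ (Fin 3))).prod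
        (ContinuousLinearMap.snd ℝ ℝ (EuclideanSpace ℝ (Fin 3))))
      (p : ℝ × EuclideanSpace ℝ (Fin 3)) :=
  ((hasDerivAt_conformalTime hc hpos ht₀ (p.2.trans ht₀)).comp_hasFDerivAt _
    hasFDerivAt_fst).prodMk hasFDerivAt_snd

theorem contMDiff_flrwToESU (hc : ContDiffOn ℝ ∞ a (Iio tmax)) (hpos : ∀ t < tmax, 0 < a t)
    (ht₀ : t₀ < tmax) :
    ContMDiff 𝓘(ℝ, ℝ × EuclideanSpace ℝ (Fin 3)) (𝓘(ℝ, ℝ).prod (𝓡 3)) ∞ (flrwToESU a t₀) := by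
  have := finrank_four
  have hG := contDiffAt_conformalCoord hc hpos ht₀
  refine ContMDiff.prodMk (fun p => ?_) (ContMDiff.codRestrict_sphere (fun p => ?_) _)
  · exact ((contDiffAt_esuTime (conformalCoord_fst_neg hc.continuousOn hpos ht₀ p)).comp _
      (hG p)).contMDiffAt.comp p (contMDiff_subtype_val p)
  · exact ((contDiff_esuVec.contDiffAt).comp _ (hG p)).contMDiffAt.comp p (contMDiff_subtype_val p)

theorem mvfderiv_fst_flrwToESU (hc : ContDiffOn ℝ ∞ a (Iio tmax)) (hpos : ∀ t < tmax, 0 < a t)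
    (ht₀ : t₀ < tmax) (p : FLRWRegion t₀)
    (v : TangentSpace 𝓘(ℝ, ℝ × EuclideanSpace ℝ (Fin 3)) p) :
    mvfderiv (𝓘(ℝ, ℝ).prod (𝓡 3)) (Prod.fst : ℝ × S3 → ℝ) (flrwToESU a t₀ p)
      (mfderiv 𝓘(ℝ, ℝ × EuclideanSpace ℝ (Fin 3)) (𝓘(ℝ, ℝ).prod (𝓡 3)) (flrwToESU a t₀) p v) =
    fderiv ℝ esuTime (conformalCoord a t₀ p)
      (1 / a (FLRWRegion.time p) * (show ℝ × EuclideanSpace ℝ (Fin 3) from v).1,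
        (show ℝ × EuclideanSpace ℝ (Fin 3) from v).2) := by
  have h1 := ((contMDiff_flrwToESU hc hpos ht₀).mdifferentiable (by simp) p).hasMFDerivAt
  have h2 : MDifferentiableAt (𝓘(ℝ, ℝ).prod (𝓡 3)) 𝓘(ℝ, ℝ) (Prod.fst : ℝ × S3 → ℝ)
      (flrwToESU a t₀ p) := mdifferentiableAt_fst
  have h3 : mvfderiv 𝓘(ℝ, ℝ × EuclideanSpace ℝ (Fin 3))
      (fun p : FLRWRegion t₀ => esuTime (conformalCoord a t₀ p)) p =
      (mvfderiv (𝓘(ℝ, ℝ).prod (𝓡 3)) (Prod.fst : ℝ × S3 → ℝ) (flrwToESU a t₀ p)).comp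
        (mfderiv 𝓘(ℝ, ℝ × EuclideanSpace ℝ (Fin 3)) (𝓘(ℝ, ℝ).prod (𝓡 3)) (flrwToESU a t₀) p) :=
    (h2.hasMFDerivAt.comp p h1).mfderiv
  have h4 := ((contDiffAt_esuTime (conformalCoord_fst_neg hc.continuousOn hpos ht₀
    p)).differentiableAt (by simp)).hasFDerivAt.comp _
    (hasFDerivAt_conformalCoord hc.continuousOn hpos ht₀ p)
  have h5 := opens_mvfderiv_comp_val (FLRWRegion t₀) p h4 v
  exact (congrArg (fun L => L v) h3).symm.trans h5

theorem mvfderiv_coe_flrwToESU (hc : ContDiffOn ℝ ∞ a (Iio tmax)) (hpos : ∀ t < tmax, 0 < a t)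
    (ht₀ : t₀ < tmax) (p : FLRWRegion t₀)
    (v : TangentSpace 𝓘(ℝ, ℝ × EuclideanSpace ℝ (Fin 3)) p) :
    mvfderiv (𝓘(ℝ, ℝ).prod (𝓡 3)) (fun p : ℝ × S3 => (p.2 : EuclideanSpace ℝ (Fin 4)))
      (flrwToESU a t₀ p)
      (mfderiv 𝓘(ℝ, ℝ × EuclideanSpace ℝ (Fin 3)) (𝓘(ℝ, ℝ).prod (𝓡 3)) (flrwToESU a t₀) p v) =
    fderiv ℝ esuVec (conformalCoord a t₀ p)
      (1 / a (FLRWRegion.time p) * (show ℝ × EuclideanSpace ℝ (Fin 3) from v).1,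
        (show ℝ × EuclideanSpace ℝ (Fin 3) from v).2) := by
  have h1 := ((contMDiff_flrwToESU hc hpos ht₀).mdifferentiable (by simp) p).hasMFDerivAt
  have h2 : MDifferentiableAt (𝓘(ℝ, ℝ).prod (𝓡 3)) 𝓘(ℝ, EuclideanSpace ℝ (Fin 4))
      (fun p : ℝ × S3 => (p.2 : EuclideanSpace ℝ (Fin 4))) (flrwToESU a t₀ p) :=
    (contMDiff_coe_S3.comp contMDiff_snd).mdifferentiable (by simp) _
  have h3 : mvfderiv 𝓘(ℝ, ℝ × EuclideanSpace ℝ (Fin 3))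
      (fun p : FLRWRegion t₀ => esuVec (conformalCoord a t₀ p)) p =
      (mvfderiv (𝓘(ℝ, ℝ).prod (𝓡 3)) (fun p : ℝ × S3 => (p.2 : EuclideanSpace ℝ (Fin 4)))
        (flrwToESU a t₀ p)).comp
        (mfderiv 𝓘(ℝ, ℝ × EuclideanSpace ℝ (Fin 3)) (𝓘(ℝ, ℝ).prod (𝓡 3)) (flrwToESU a t₀) p) :=
    (h2.hasMFDerivAt.comp p h1).mfderiv
  have h4 := (contDiff_esuVec.differentiable (by simp) _).hasFDerivAt.comp _
    (hasFDerivAt_conformalCoord hc.continuousOn hpos ht₀ p)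
  have h5 := opens_mvfderiv_comp_val (FLRWRegion t₀) p h4 v
  exact (congrArg (fun L => L v) h3).symm.trans h5

theorem flrw_metric_apply (hc₀ : ContDiffOn ℝ ∞ a (Iio t₀)) (hpos₀ : ∀ t < t₀, 0 < a t)
    (p : FLRWRegion t₀) (v w : TangentSpace 𝓘(ℝ, ℝ × EuclideanSpace ℝ (Fin 3)) p) :
    (flrw a t₀ hc₀ hpos₀).metric p v w =
      -((show ℝ × EuclideanSpace ℝ (Fin 3) from v).1 *
        (show ℝ × EuclideanSpace ℝ (Fin 3) from w).1) +
      a (FLRWRegion.time p) ^ 2 * inner ℝ (show ℝ × EuclideanSpace ℝ (Fin 3) from v).2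
        (show ℝ × EuclideanSpace ℝ (Fin 3) from w).2 := by
  refine (warpedForm_apply _ _ _ _ _ _).trans ?_
  rw [FLRWRegion.mvfderiv_time, FLRWRegion.mvfderiv_time, FLRWRegion.mvfderiv_space,
    FLRWRegion.mvfderiv_space]

theorem flrwToESU_pullback {k : ℕ∞} (hc : ContDiffOn ℝ ∞ a (Iio tmax))
    (hpos : ∀ t < tmax, 0 < a t) (ht₀ : t₀ < tmax) (hc₀ : ContDiffOn ℝ ∞ a (Iio t₀))
    (hpos₀ : ∀ t < t₀, 0 < a t) (p : FLRWRegion t₀)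
    (v w : TangentSpace 𝓘(ℝ, ℝ × EuclideanSpace ℝ (Fin 3)) p) :
    (einsteinStatic k).metric (flrwToESU a t₀ p)
      (mfderiv 𝓘(ℝ, ℝ × EuclideanSpace ℝ (Fin 3)) (𝓘(ℝ, ℝ).prod (𝓡 3)) (flrwToESU a t₀) p v)
      (mfderiv 𝓘(ℝ, ℝ × EuclideanSpace ℝ (Fin 3)) (𝓘(ℝ, ℝ).prod (𝓡 3)) (flrwToESU a t₀) p w) =
    (flatFactor (conformalCoord a t₀ p) / a (FLRWRegion.time p)) ^ 2 *
      (flrw a t₀ hc₀ hpos₀).metric p v w := by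
  have ha := hpos (FLRWRegion.time p) (p.2.trans ht₀)
  rw [flrw_metric_apply]
  change warpedForm _ _ _ _ _ _ _ = _
  rw [warpedForm_apply, mvfderiv_fst_flrwToESU hc hpos ht₀,
    mvfderiv_fst_flrwToESU hc hpos ht₀, mvfderiv_coe_flrwToESU hc hpos ht₀,
    mvfderiv_coe_flrwToESU hc hpos ht₀, one_pow, one_mul,
    esu_pullback (conformalCoord_fst_neg hc.continuousOn hpos ht₀ p)]
  field_simp

theorem flrwToESU_immersion (hc : ContDiffOn ℝ ∞ a (Iio tmax))
    (hpos : ∀ t < tmax, 0 < a t) (ht₀ : t₀ < tmax) (p : FLRWRegion t₀) :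
    Function.Injective
      (mfderiv 𝓘(ℝ, ℝ × EuclideanSpace ℝ (Fin 3)) (𝓘(ℝ, ℝ).prod (𝓡 3)) (flrwToESU a t₀) p) := by
  rw [injective_iff_map_eq_zero]
  intro v hv
  have ha := hpos (FLRWRegion.time p) (p.2.trans ht₀)
  obtain ⟨v1, v2⟩ : ℝ × EuclideanSpace ℝ (Fin 3) := v
  have h1 := flrwToESU_pullback (k := 0) hc hpos ht₀ (hc.mono (Iio_subset_Iio ht₀.le))
    (fun t ht => hpos t (ht.trans ht₀)) p (v1, v2) (-v1, v2)
  have h2 : (flrw a t₀ (hc.mono (Iio_subset_Iio ht₀.le))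
      (fun t ht => hpos t (ht.trans ht₀))).metric p (v1, v2) (-v1, v2) = 0 := by
    refine (mul_eq_zero.1 (h1.symm.trans ?_)).resolve_left
      (pow_pos (div_pos flatFactor_pos ha) 2).ne'
    rw [hv, map_zero]
    rfl
  have h3 := (flrw_metric_apply _ _ p (v1, v2) (-v1, v2)).symm.trans h2
  simp only [real_inner_self_eq_norm_sq] at h3
  have h4 : v1 = 0 := by
    have := mul_nonneg (sq_nonneg (a (FLRWRegion.time p))) (sq_nonneg ‖v2‖)
    nlinarith
  have h5 : v2 = 0 := by
    rw [h4] at h3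
    have : a (FLRWRegion.time p) ^ 2 * ‖v2‖ ^ 2 = 0 := by linarith
    simpa [ha.ne'] using this
  rw [h4, h5]
  rfl

theorem sin_add_flrwToESU (hc : ContinuousOn a (Iio tmax)) (hpos : ∀ t < tmax, 0 < a t)
    (ht₀ : t₀ < tmax) (p : FLRWRegion t₀) :
    Real.sin (flrwToESU a t₀ p).1 + (flrwToESU a t₀ p).2.1 0 = flatFactor (conformalCoord a t₀ p) :=
  sin_esuTime_add (conformalCoord_fst_neg hc hpos ht₀ p)

theorem cos_flrwToESU (hc : ContinuousOn a (Iio tmax)) (hpos : ∀ t < tmax, 0 < a t)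
    (ht₀ : t₀ < tmax) (p : FLRWRegion t₀) :
    Real.cos (flrwToESU a t₀ p).1 =
      -flatFactor (conformalCoord a t₀ p) * conformalTime a t₀ (FLRWRegion.time p) :=
  cos_esuTime (conformalCoord_fst_neg hc hpos ht₀ p)

theorem neg_cos_div_flrwToESU (hc : ContinuousOn a (Iio tmax)) (hpos : ∀ t < tmax, 0 < a t)
    (ht₀ : t₀ < tmax) (p : FLRWRegion t₀) :
    -Real.cos (flrwToESU a t₀ p).1 /
      (Real.sin (flrwToESU a t₀ p).1 + (flrwToESU a t₀ p).2.1 0) = conformalTime a t₀ (FLRWRegion.time p) := by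
  rw [sin_add_flrwToESU hc hpos ht₀, cos_flrwToESU hc hpos ht₀, neg_mul, neg_neg,
    mul_div_cancel_left₀ _ flatFactor_pos.ne']

theorem range_flrwToESU (hc : ContinuousOn a (Iio tmax)) (hpos : ∀ t < tmax, 0 < a t)
    (ht₀ : t₀ < tmax) {s : ℝ → ℝ} (hs : ∀ y, s y ≤ t₀)
    (hηs : ∀ y ≤ 0, conformalTime a t₀ (s y) = y) :
    range (flrwToESU a t₀) = esuRegion := by
  refine subset_antisymm ?_ fun p hp => ?_
  · rintro _ ⟨p, rfl⟩
    refine mem_esuRegion_iff.2 ⟨esuTime_mem, ?_⟩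
    rw [sin_add_flrwToESU hc hpos ht₀]
    exact flatFactor_pos
  · obtain ⟨h1, h2⟩ := mem_esuRegion_iff.1 hp
    obtain ⟨⟨y, x⟩, hy, hT, hq⟩ := exists_esu_eq (norm_S3 p.2) h1 h2
    have h3 := hηs y hy.le
    have h4 : s y < t₀ := lt_of_le_of_ne (hs y) fun h4 => by
      rw [h4, conformalTime_self] at h3
      exact hy.ne h3.symm
    refine ⟨⟨(s y, x), h4⟩, ?_⟩
    have h5 : conformalCoord a t₀ (s y, x) = (y, x) := Prod.ext h3 rfl
    exact Prod.ext ((congrArg esuTime h5).trans hT) (Subtype.ext ((congrArg esuVec h5).trans hq))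

theorem isEmbedding_flrwToESU (hc : ContDiffOn ℝ ∞ a (Iio tmax)) (hpos : ∀ t < tmax, 0 < a t)
    (ht₀ : t₀ < tmax) {s : ℝ → ℝ} (hs : Continuous s)
    (hsη : ∀ t ≤ t₀, s (conformalTime a t₀ t) = t) :
    Topology.IsEmbedding (flrwToESU a t₀) := by
  set g : ℝ × S3 → ℝ × EuclideanSpace ℝ (Fin 3) := fun p =>
    (s (-Real.cos p.1 / (Real.sin p.1 + p.2.1 0)),
      (Real.sin p.1 + p.2.1 0)⁻¹ • tailVec p.2) with hg
  have hg1 : ∀ p, g (flrwToESU a t₀ p) = p := fun p => by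
    refine Prod.ext ?_ ?_
    · simp only [hg, neg_cos_div_flrwToESU hc.continuousOn hpos ht₀]
      exact hsη _ (le_of_lt p.2)
    · simp only [hg, sin_add_flrwToESU hc.continuousOn hpos ht₀]
      change _ • tailVec (esuVec _) = _
      rw [tailVec_esuVec, inv_smul_smul₀ flatFactor_pos.ne']
      rfl
  have hgc : ∀ p, ContinuousAt g (flrwToESU a t₀ p) := fun p => by
    have h1 : Real.sin (flrwToESU a t₀ p).1 + (flrwToESU a t₀ p).2.1 0 ≠ 0 := by
      rw [sin_add_flrwToESU hc.continuousOn hpos ht₀]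
      exact flatFactor_pos.ne'
    have h2 : Continuous (fun p : ℝ × S3 => Real.sin p.1 + p.2.1 0) := by fun_prop
    have h3 : Continuous (fun p : ℝ × S3 => -Real.cos p.1) := by fun_prop
    have h4 : Continuous (fun p : ℝ × S3 => tailVec p.2) := by
      exact continuous_tailVec.comp (by fun_prop)
    exact (hs.continuousAt.comp (h3.continuousAt.div h2.continuousAt h1)).prodMk
      ((h2.continuousAt.inv₀ h1).smul h4.continuousAt)
  refine ⟨Topology.isInducing_iff_nhds.2 fun p => le_antisymm ?_ ?_, fun p p' hpp' => ?_⟩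
  · exact ((contMDiff_flrwToESU hc hpos ht₀).continuous.tendsto p).le_comap
  · rw [nhds_subtype_eq_comap, ← tendsto_iff_comap]
    have h1 := (hgc p).tendsto.comp (tendsto_comap (f := flrwToESU a t₀))
    rw [hg1] at h1
    exact h1.congr hg1
  · exact Subtype.ext (by rw [← hg1 p, ← hg1 p', hpp'])

theorem esuFactor_flrwToESU (hc : ContinuousOn a (Iio tmax)) (hpos : ∀ t < tmax, 0 < a t)
    (ht₀ : t₀ < tmax) {s : ℝ → ℝ} (hsη : ∀ t ≤ t₀, s (conformalTime a t₀ t) = t)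
    (p : FLRWRegion t₀) :
    esuFactor (fun y => (a (s y))⁻¹) h (flrwToESU a t₀ p) =
      flatFactor (conformalCoord a t₀ p) / a (FLRWRegion.time p) := by
  rw [esuFactor, homogeneousExtension, neg_cos_div_flrwToESU hc hpos ht₀,
    sin_add_flrwToESU hc hpos ht₀, if_pos flatFactor_pos, hsη (FLRWRegion.time p) (le_of_lt p.2), div_eq_mul_inv]

theorem tendsto_half_neg_atBot (c : ℝ) :
    Tendsto (fun y : ℝ => (1 - y ^ 2 + c ^ 2) / (-2 * y)) atBot atBot := by
  have h1 : Tendsto (fun y : ℝ => 1 / 2 * y + (1 + c ^ 2) / 2) atBot atBot :=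
    tendsto_atBot_add_const_right _ _ (tendsto_id.const_mul_atBot one_half_pos)
  refine tendsto_atBot_mono' _ ?_ h1
  filter_upwards [eventually_le_atBot (-1)] with y hy
  rw [div_le_iff₀ (by linarith)]
  have := mul_nonneg (add_nonneg zero_le_one (sq_nonneg c)) (show 0 ≤ -y - 1 by linarith)
  nlinarith

theorem tendsto_flrwToESU_comoving (hc : ContDiffOn ℝ ∞ a (Iio tmax))
    (hpos : ∀ t < tmax, 0 < a t) (ht₀ : t₀ < tmax)
    (hlim : Tendsto (conformalTime a t₀) atBot atBot) (x : EuclideanSpace ℝ (Fin 3)) :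
    Tendsto (fun t : Iio t₀ => flrwToESU a t₀ (FLRWRegion.comoving x t)) atBot (𝓝 pointO) := by
  have hval : Tendsto (Subtype.val : Iio t₀ → ℝ) atBot atBot :=
    tendsto_comp_val_Iio_atBot.2 tendsto_id
  have hT : Tendsto (fun t : Iio t₀ => (flrwToESU a t₀ (FLRWRegion.comoving x t)).1) atBot
      (𝓝 (-(Real.pi / 2))) :=
    (Real.tendsto_arctan_atBot.mono_right nhdsWithin_le_nhds).comp
      ((tendsto_half_neg_atBot ‖x‖).comp (hlim.comp hval))
  refine hT.prodMk_nhds ?_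
  rw [tendsto_subtype_rng, tendsto_iff_norm_sub_tendsto_zero]
  have h1 : Tendsto (fun t : Iio t₀ =>
      √(2 + 2 * Real.sin (flrwToESU a t₀ (FLRWRegion.comoving x t)).1)) atBot (𝓝 0) := by
    have h2 : Continuous (fun T : ℝ => √(2 + 2 * Real.sin T)) := by fun_prop
    simpa [Function.comp_def] using (h2.tendsto (-(Real.pi / 2))).comp hT
  refine squeeze_zero (fun _ => norm_nonneg _) (fun t => Real.le_sqrt_of_sq_le ?_) h1
  change ‖((flrwToESU a t₀ (FLRWRegion.comoving x t)).2 : EuclideanSpace ℝ (Fin 4)) -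
    ((northPole : S3) : EuclideanSpace ℝ (Fin 4))‖ ^ 2 ≤ _
  rw [norm_sub_sq_real, norm_S3, norm_S3, real_inner_comm, inner_northPole]
  have h2 := sin_add_flrwToESU hc.continuousOn hpos ht₀ (FLRWRegion.comoving x t)
  have h3 := flatFactor_pos (p := conformalCoord a t₀ (FLRWRegion.comoving x t))
  linarith

end Embedding

end

theorem proposition4p2 (tmax : ℝ) (a : ℝ → ℝ) (hsmooth : ContDiffOn ℝ ∞ a (Iio tmax))
    (hpos : ∀ t < tmax, 0 < a t) (h : ℝ) (hh : 0 < h)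
    (hasymp : (fun t => a t - Real.exp (h * t)) =o[atBot] (fun t => Real.exp (h * t)) ∨
      Tendsto (fun t => deriv a t / a t) atBot (𝓝 h))
    (t₀ : ℝ) (ht₀ : t₀ < tmax) :
    ∃ (φ : FLRWRegion t₀ → ℝ × S3) (Ω : ℝ × S3 → ℝ),
      IsConformalEmbedding
        (flrw a t₀ (hsmooth.mono (Iio_subset_Iio ht₀.le)) (fun t ht => hpos t (ht.trans ht₀)))
        (einsteinStatic 0) φ Ω ∧
      ContMDiff 𝓘(ℝ, ℝ × EuclideanSpace ℝ (Fin 3)) (𝓘(ℝ, ℝ).prod (𝓡 3)) ∞ φ ∧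
      (∀ p : FLRWRegion t₀,
        Ω (φ p) = h * Real.cos (φ p).1 / omegaFactor a h t₀ (FLRWRegion.time p)) ∧
      conformalBoundary (range φ) Ω = {EinsteinStatic.pointO} ∪ {EinsteinStatic.pointP} ∧
      EinsteinStatic.pointO ≠ EinsteinStatic.pointP ∧
      pastConformalBoundary (einsteinStatic 0) (range φ) Ω = {EinsteinStatic.pointO} ∧
      futureConformalBoundary (einsteinStatic 0) (range φ) Ω = ∅ ∧
      pastBoundary (einsteinStatic 0) (range φ) Ω = EinsteinStatic.coneB ∧
      futureBoundary (einsteinStatic 0) (range φ) Ω =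
        EinsteinStatic.sigmaPlus \ {EinsteinStatic.pointP} ∧
      (∀ x : EuclideanSpace ℝ (Fin 3),
        Tendsto (fun t : Iio t₀ => φ (FLRWRegion.comoving x t)) atBot
          (𝓝 EinsteinStatic.pointO)) ∧
      IsOpen EinsteinStatic.belowSigma ∧
      EinsteinStatic.pointO ∈ EinsteinStatic.belowSigma ∧
      range φ =
        (einsteinStatic 0).timelikeFuture EinsteinStatic.pointO EinsteinStatic.belowSigma := by
  have hc := hsmooth.continuousOn
  have hη := tendsto_conformalTime hsmooth hpos ht₀ hh hasymp
  obtain ⟨s, hs, hs₀, hηs, hsη, hslim⟩ := exists_inverse_conformalTime hc hpos ht₀ hη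
  have hst : ∀ y, s y < tmax := fun y => (hs₀ y).trans_lt ht₀
  have hb : Continuous (fun y => (a (s y))⁻¹) :=
    (hc.comp_continuous hs hst).inv₀ fun y => (hpos _ (hst y)).ne'
  have hb0 : ∀ y, 0 < (a (s y))⁻¹ := fun y => inv_pos.2 (hpos _ (hst y))
  have hblim : Tendsto (fun y => (a (s y))⁻¹ / -y) atBot (𝓝 h) := by
    have h1 := ((tendsto_scaleFactor_mul_conformalTime hsmooth hpos ht₀ hh hasymp).comp
      hslim).inv₀ (inv_ne_zero hh.ne')
    rw [inv_inv] at h1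
    refine h1.congr' ?_
    filter_upwards [eventually_le_atBot 0] with y hy
    rw [Function.comp_apply, hηs y hy, mul_inv, div_eq_mul_inv]
  have hrange := range_flrwToESU hc hpos ht₀ hs₀ hηs
  have hφ := contMDiff_flrwToESU hsmooth hpos ht₀
  have hΩ := fun p => esuFactor_flrwToESU (h := h) hc hpos ht₀ hsη p
  refine ⟨flrwToESU a t₀, EinsteinStatic.esuFactor (fun y => (a (s y))⁻¹) h, ?_, hφ, fun p => ?_, ?_,
    EinsteinStatic.pointO_ne_pointP, ?_, ?_, ?_, ?_,
    tendsto_flrwToESU_comoving hsmooth hpos ht₀ hη, isOpen_lt continuous_fst continuous_const, ?_, ?_⟩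
  · refine
      { contMDiff := hφ.of_le (by simp)
        immersion := flrwToESU_immersion hsmooth hpos ht₀
        isEmbedding := isEmbedding_flrwToESU hsmooth hpos ht₀ hs hsη
        isOpen_range := hrange ▸ EinsteinStatic.isOpen_esuRegion
        range_ne_univ := ?_
        contMDiffOn_factor := ?_
        factor_nonneg := ?_
        contMDiff_factor := fun p => ?_
        factor_pos := fun p => ?_
        conformalBoundary_nonempty := ?_
        pullback_eq := fun p v w => ?_ }
    · rw [hrange]
      intro hu
      have h1 : EinsteinStatic.pointP ∈ EinsteinStatic.esuRegion := hu ▸ mem_univ _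
      exact lt_irrefl _ h1.2
    · rw [hrange]
      exact contMDiffOn_zero_iff.2 (EinsteinStatic.continuousOn_esuFactor hb hblim)
    · rw [hrange]
      exact fun p hp => EinsteinStatic.esuFactor_nonneg hb0 hh hp
    · have h1 : EinsteinStatic.esuFactor (fun y => (a (s y))⁻¹) h ∘ flrwToESU a t₀ =
          (fun q : ℝ × EuclideanSpace ℝ (Fin 3) =>
            flatFactor (conformalCoord a t₀ q) / a q.1) ∘ Subtype.val := funext hΩ
      rw [h1]
      have h2 : ContDiffAt ℝ ∞ a (p : ℝ × EuclideanSpace ℝ (Fin 3)).1 :=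
        hsmooth.contDiffAt (Iio_mem_nhds (p.2.trans ht₀))
      have h3 := (contDiff_flatFactor.contDiffAt.comp _
        (contDiffAt_conformalCoord hsmooth hpos ht₀ p)).div (h2.comp _ contDiffAt_fst)
        (hpos _ (p.2.trans ht₀)).ne'
      exact h3.contMDiffAt.comp p (contMDiff_subtype_val p)
    · rw [hΩ]
      exact div_pos flatFactor_pos (hpos _ (p.2.trans ht₀))
    · rw [hrange, EinsteinStatic.conformalBoundary_esuRegion hb0 hh]
      exact ⟨_, Or.inl rfl⟩
    · rw [hΩ]
      exact flrwToESU_pullback hsmooth hpos ht₀ _ _ p v w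
  · have h1 := conformalTime_neg hc hpos ht₀ p.2
    have h2 := hpos (FLRWRegion.time p) (p.2.trans ht₀)
    rw [hΩ, cos_flrwToESU hc hpos ht₀, omegaFactor_eq]
    have h3 : conformalTime a t₀ (FLRWRegion.time p) ≠ 0 := h1.ne
    field_simp
  · rw [hrange, EinsteinStatic.conformalBoundary_esuRegion hb0 hh]
  · rw [hrange, EinsteinStatic.pastConformalBoundary_esuRegion hb0 hh]
  · rw [hrange, EinsteinStatic.futureConformalBoundary_esuRegion hb0 hh]
  · rw [hrange, EinsteinStatic.pastBoundary_esuRegion hb0 hh]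
  · rw [hrange, EinsteinStatic.futureBoundary_esuRegion hb0 hh]
  · have := Real.pi_pos
    change -(Real.pi / 2) < Real.pi / 2
    linarith
  · rw [hrange, EinsteinStatic.esuRegion_eq_timelikeFuture]
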